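/- Let $C(\mathbb R^2)$ be the Polish space of continuous functions $F:\mathbb R^2\to\mathbb R$ with the topology of uniform convergence on compact sets. Identify $(F,x,y)\in C(\mathbb R^2)\times\mathbb R^2$ with the Cauchy problem $\varphi'(t)=F(t,\varphi(t))$, $\varphi(x)=y$, and let $\mathcal G\subseteq C(\mathbb R^2)\times\mathbb R^2$ be the set of all $(F,x,y)$ that admit a global solution, i.e. for which there is a differentiable function $\varphi:\mathbb R\to\mathbb R$ with $\varphi(x)=y$ and $\varphi'(t)=F(t,\varphi(t))$ for every $t\in\mathbb R$. Theorem. $\mathcal G$ is $\boldsymbol\Sigma^0_4$-complete. That is, $\mathcal G$ is a $\boldsymbol\Sigma^0_4$ subset of $C(\mathbb R^2)\times\mathbb R^2$, and for every zero-dimensional Polish space $X$ (i.e. a Polish space whose clopen sets form a basis) and every $\boldsymbol\Sigma^0_4$ set $B\subseteq X$ there is a continuous map $f:X\to C(\mathbb R^2)\times\mathbb R^2$ such that $f^{-1}(\mathcal G)=B$. Here $\boldsymbol\Sigma^0_1$ sets are the open sets and, for $n\ge 2$, a set is $\boldsymbol\Sigma^0_n$ if it is a union $\bigcup_{i\in\mathbb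 N}A_i$ in which the complement of each $A_i$ is $\boldsymbol\Sigma^0_{m_i}$ for some $1\le m_i<n$. -/

import Mathlib

universe u v

/-- The additive finite levels `Σ⁰ₙ`, `1 ≤ n < ω`, of the Borel hierarchy of a topological space
(there are no sets of level `0`). A set is `Σ⁰₁` if it is open, and it is `Σ⁰ₙ` with `n ≥ 2` if it
is a countable union of sets `A i`, where each `A i` is `Π⁰ₘ` for some `1 ≤ m < n` (depending on
`i`), that is, the complement of `A i` is `Σ⁰ₘ`. -/
inductive IsSigmaZero {X : Type u} [TopologicalSpace X] : ℕ → Set X → Prop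
  | of_isOpen (U : Set X) (hU : IsOpen U) : IsSigmaZero 1 U
  | iUnion (n : ℕ) (A : ℕ → Set X) (m : ℕ → ℕ) (hm : ∀ i, 1 ≤ m i ∧ m i < n)
      (hA : ∀ i, IsSigmaZero (m i) (A i)ᶜ) : IsSigmaZero n (⋃ i, A i)

/-- A topological space is zero-dimensional if its clopen sets form a basis. -/
def IsZeroDimensional (X : Type u) [TopologicalSpace X] : Prop :=
  TopologicalSpace.IsTopologicalBasis {s : Set X | IsClopen s}

/-- A subset `A` of a Polish space `Y` is `Σ⁰ₙ`-hard if every `Σ⁰ₙ` subset `B` of every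
zero-dimensional Polish space `X` is a continuous preimage of `A` (Wadge reduction). -/
def IsSigmaZeroHard {Y : Type v} [TopologicalSpace Y] [PolishSpace Y] (n : ℕ) (A : Set Y) : Prop :=
  ∀ (X : Type u) [TopologicalSpace X] [PolishSpace X], IsZeroDimensional X →
    ∀ B : Set X, IsSigmaZero n B → ∃ f : X → Y, Continuous f ∧ f ⁻¹' A = B

/-- A subset of a Polish space is `Σ⁰ₙ`-complete if it is `Σ⁰ₙ` and `Σ⁰ₙ`-hard. -/
def IsSigmaZeroComplete {Y : Type v} [TopologicalSpace Y] [PolishSpace Y]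
    (n : ℕ) (A : Set Y) : Prop :=
  IsSigmaZero n A ∧ IsSigmaZeroHard.{u, v} n A

/-- The space of Cauchy problems `(F, x, y)`, standing for `φ' (t) = F (t, φ t)`, `φ x = y`.
The function space carries the topology of uniform convergence on compact sets
(the compact-open topology). -/
abbrev CauchyProblem : Type := C(ℝ × ℝ, ℝ) × (ℝ × ℝ)

/-- The function `φ`, defined on the whole real line, solves the Cauchy problem `(F, x, y)`
(as `F` is continuous, `φ` is then automatically continuously differentiable). -/
def IsGlobalSolution (P : CauchyProblem) (φ : ℝ → ℝ) : Prop :=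
  φ P.2.1 = P.2.2 ∧ ∀ t : ℝ, HasDerivAt φ (P.1 (t, φ t)) t

/-- The set of Cauchy problems that admit a global solution. -/
def globallySolvable : Set CauchyProblem :=
  {P | ∃ φ : ℝ → ℝ, IsGlobalSolution P φ}

/-!
Translating the initial point to the origin and reversing time splits a Cauchy problem into two
problems `ψ' = F (t, ψ)`, `ψ 0 = 0` on `[0, ∞)` (`sideField`, `exists_isGlobalSolution`), and the
upper bound reduces to showing that the set `rightSolvable` of the fields `F` with a solution on
`[0, ∞)` is `Σ⁰₄`.

**Upper bound.** A condition saying that some solution exists up to a given time within given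
compact bounds is closed in `F`, by compactness of the family of these solutions
(`isClosed_boundedPathSet`). Solutions in the plane can be compared: two of them that cross can be
glued, and by Peano's theorem a solution below another one continues below it until it is far down
(`IsPath.exists_extension_le`). Fix a position at time `K`. It may or may not be possible to drive
solutions from it to `+∞`, respectively to `-∞`, within bounded time (`ReachesUp`, `ReachesDown`).
There are two ways for `F` to be solvable.
* For some bound `k` on `[0, K]` the solutions exist for arbitrarily long times, but their lowest
  position at time `K` cannot be driven to `-∞` (`stayingAbove`), or symmetrically with `+∞`. Then
  decreasing longer and longer solutions from this position gives a global one
  (`rightSolvable_of_not_reachesDown`).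
* At every time `K` some position can be driven to `-∞` (`fallingAfter`) and some to `+∞`. This
  always suffices (`rightSolvable_of_reaches`): if at every time one position can be driven to both,
  these positions can be connected, since the escaping solutions sweep across everything; and
  otherwise the position separating the two kinds survives.

Every solvable field falls under one of these cases (`mem_rightSolvable_iff`). The first is
`∃ K k, ∀ n, ∃ m` of a difference of closed conditions, hence `Σ⁰₄`, and the second is
`∀ K, ∃ k n` of a closed condition, hence `Π⁰₃`.

**Hardness.** Write a `Σ⁰₄` set `B` as an increasing union of the sets `⋂ i, E k i` with `E k i` of
type `F_σ`. As the space is zero-dimensional, membership in an `F_σ` set is the finiteness of a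
function to `ℕ∞` whose finite levels are closed (`IsFSigma.exists_hasClosedLevels`). Partial sums of
these functions give heights `h k N`, increasing in `N`, such that `x ∈ B` if and only if for some
`k` all `h k N` are finite. The field `gateField` first spreads the solutions out to all of
`(-∞, 0]` (`funnel`). Afterwards, in the stage `[N + 1, N + 2]` it lifts solutions across the
intervals between consecutive integers, one after the other, in shorter and shorter windows of time.
The lift across `[a, a + 1]` uses a multiple of `√(1 - (2 (z - a) - 1) ^ 2)`, for which `a` is a
stationary point of non-uniqueness, and an additional nonnegative term that pushes the solutions off
`a`. The latter vanishes exactly on the closed set of those `x` with `a = h k (N + 1) - k` for some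
`k ≤ N`: for these `x` solutions may rest at `a`. Thus a solution at height at least `h k N - k` is
lifted to `h k (N + 1) - k`, where it may rest, and it blows up if this is infinite. A solution
starts above one of the lanes `N ↦ h k N - k` and remains above it,
which forces the lane to be finite, and conversely a finite lane can be followed
(`gateField_mem_rightSolvable_iff`).
-/

/-! ### Normal forms for the low levels of the Borel hierarchy -/

/-- A countable union of closed sets. -/
def IsFSigma {X : Type*} [TopologicalSpace X] (S : Set X) : Prop :=
  ∃ C : ℕ → Set X, (∀ i, IsClosed (C i)) ∧ S = ⋃ i, C i

/-- A countable intersection of `F_σ` sets, that is, a `Π⁰₃` set. -/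
def IsPiThree {X : Type*} [TopologicalSpace X] (S : Set X) : Prop :=
  ∃ E : ℕ → Set X, (∀ i, IsFSigma (E i)) ∧ S = ⋂ i, E i

/-- A countable union of `Π⁰₃` sets, that is, a `Σ⁰₄` set. -/
def IsSigmaFour {X : Type*} [TopologicalSpace X] (S : Set X) : Prop :=
  ∃ A : ℕ → Set X, (∀ i, IsPiThree (A i)) ∧ S = ⋃ i, A i

section NormalForms

variable {X Y : Type*} [TopologicalSpace X] [TopologicalSpace Y]

lemma IsFSigma.of_isClosed {S : Set X} (h : IsClosed S) : IsFSigma S :=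
  ⟨fun _ => S, fun _ => h, (Set.iUnion_const S).symm⟩

lemma IsFSigma.iUnion {ι : Sort*} [Countable ι] {S : ι → Set X} (h : ∀ i, IsFSigma (S i)) :
    IsFSigma (⋃ i, S i) := by
  choose C hC hS using h
  rcases isEmpty_or_nonempty ι with hι | hι
  · exact ⟨fun _ => ∅, fun _ => isClosed_empty, by simp⟩
  obtain ⟨e, he⟩ := exists_surjective_nat (PLift ι × ℕ)
  refine ⟨fun n => C (e n).1.down (e n).2, fun n => hC _ _, ?_⟩
  rw [he.iUnion_comp (fun p : PLift ι × ℕ => C p.1.down p.2),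
    Set.iUnion_prod' (fun p : PLift ι × ℕ => C p.1.down p.2)]
  simp only [hS]
  exact (Set.iUnion_plift_down fun i => ⋃ j, C i j).symm

lemma IsFSigma.inter {S T : Set X} (hS : IsFSigma S) (hT : IsFSigma T) : IsFSigma (S ∩ T) := by
  obtain ⟨C, hC, rfl⟩ := hS
  obtain ⟨D, hD, rfl⟩ := hT
  rw [Set.iUnion_inter_iUnion]
  exact IsFSigma.iUnion fun i => IsFSigma.iUnion fun j => IsFSigma.of_isClosed ((hC _).inter (hD _))

lemma IsFSigma.biInter_finset {ι : Type*} (s : Finset ι) {S : ι → Set X}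
    (h : ∀ i, IsFSigma (S i)) : IsFSigma (⋂ i ∈ s, S i) := by
  classical
  induction s using Finset.induction_on with
  | empty => simpa using IsFSigma.of_isClosed isClosed_univ
  | insert a s _ ih =>
    rw [Finset.set_biInter_insert]
    exact (h a).inter ih

lemma IsFSigma.preimage {S : Set Y} (hS : IsFSigma S) {f : X → Y} (hf : Continuous f) :
    IsFSigma (f ⁻¹' S) := by
  obtain ⟨C, hC, rfl⟩ := hS
  exact ⟨fun i => f ⁻¹' C i, fun i => (hC i).preimage hf, Set.preimage_iUnion⟩

lemma IsFSigma.of_isOpen [TopologicalSpace.PseudoMetrizableSpace X] {S : Set X} (h : IsOpen S) :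
    IsFSigma S := by
  let := TopologicalSpace.pseudoMetrizableSpacePseudoMetric X
  obtain ⟨F, hF, -, hU, -⟩ := h.exists_iUnion_isClosed
  exact ⟨F, hF, hU.symm⟩

lemma IsPiThree.of_isFSigma {S : Set X} (h : IsFSigma S) : IsPiThree S :=
  ⟨fun _ => S, fun _ => h, (Set.iInter_const S).symm⟩

lemma IsPiThree.iInter {ι : Sort*} [Countable ι] {S : ι → Set X} (h : ∀ i, IsPiThree (S i)) :
    IsPiThree (⋂ i, S i) := by
  choose C hC hS using h
  rcases isEmpty_or_nonempty ι with hι | hι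
  · exact ⟨fun _ => Set.univ, fun _ => IsFSigma.of_isClosed isClosed_univ, by simp⟩
  obtain ⟨e, he⟩ := exists_surjective_nat (PLift ι × ℕ)
  refine ⟨fun n => C (e n).1.down (e n).2, fun n => hC _ _, ?_⟩
  rw [he.iInter_comp (fun p : PLift ι × ℕ => C p.1.down p.2)]
  ext x
  simp [hS, PLift.forall]

lemma IsPiThree.inter {S T : Set X} (hS : IsPiThree S) (hT : IsPiThree T) :
    IsPiThree (S ∩ T) := by
  rw [Set.inter_eq_iInter]
  exact IsPiThree.iInter fun b => by cases b <;> assumption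

lemma IsPiThree.preimage {S : Set Y} (hS : IsPiThree S) {f : X → Y} (hf : Continuous f) :
    IsPiThree (f ⁻¹' S) := by
  obtain ⟨C, hC, rfl⟩ := hS
  exact ⟨fun i => f ⁻¹' C i, fun i => (hC i).preimage hf, Set.preimage_iInter⟩

lemma IsSigmaFour.of_isPiThree {S : Set X} (h : IsPiThree S) : IsSigmaFour S :=
  ⟨fun _ => S, fun _ => h, (Set.iUnion_const S).symm⟩

lemma IsSigmaFour.iUnion {ι : Sort*} [Countable ι] {S : ι → Set X} (h : ∀ i, IsSigmaFour (S i)) :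
    IsSigmaFour (⋃ i, S i) := by
  choose C hC hS using h
  rcases isEmpty_or_nonempty ι with hι | hι
  · exact ⟨fun _ => ∅, fun _ => .of_isFSigma (.of_isClosed isClosed_empty), by simp⟩
  obtain ⟨e, he⟩ := exists_surjective_nat (PLift ι × ℕ)
  refine ⟨fun n => C (e n).1.down (e n).2, fun n => hC _ _, ?_⟩
  rw [he.iUnion_comp (fun p : PLift ι × ℕ => C p.1.down p.2),
    Set.iUnion_prod' (fun p : PLift ι × ℕ => C p.1.down p.2)]
  simp only [hS]
  exact (Set.iUnion_plift_down fun i => ⋃ j, C i j).symm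

lemma IsSigmaFour.union {S T : Set X} (hS : IsSigmaFour S) (hT : IsSigmaFour T) :
    IsSigmaFour (S ∪ T) := by
  rw [Set.union_eq_iUnion]
  exact IsSigmaFour.iUnion fun b => by cases b <;> assumption

lemma IsSigmaFour.inter {S T : Set X} (hS : IsSigmaFour S) (hT : IsSigmaFour T) :
    IsSigmaFour (S ∩ T) := by
  obtain ⟨C, hC, rfl⟩ := hS
  obtain ⟨D, hD, rfl⟩ := hT
  rw [Set.iUnion_inter_iUnion]
  exact IsSigmaFour.iUnion fun i => IsSigmaFour.iUnion fun j => .of_isPiThree ((hC _).inter (hD _))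

lemma IsSigmaFour.preimage {S : Set Y} (hS : IsSigmaFour S) {f : X → Y} (hf : Continuous f) :
    IsSigmaFour (f ⁻¹' S) := by
  obtain ⟨C, hC, rfl⟩ := hS
  exact ⟨fun i => f ⁻¹' C i, fun i => (hC i).preimage hf, Set.preimage_iUnion⟩

lemma IsFSigma.isSigmaZero {S : Set X} (h : IsFSigma S) : IsSigmaZero 2 S := by
  obtain ⟨C, hC, rfl⟩ := h
  exact .iUnion 2 C (fun _ => 1) (by simp) fun i => .of_isOpen _ (hC i).isOpen_compl

lemma IsPiThree.isSigmaZero_compl {S : Set X} (h : IsPiThree S) : IsSigmaZero 3 Sᶜ := by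
  obtain ⟨E, hE, rfl⟩ := h
  rw [Set.compl_iInter]
  exact .iUnion 3 _ (fun _ => 2) (by simp) fun i => by simpa using (hE i).isSigmaZero

lemma IsSigmaFour.isSigmaZero {S : Set X} (h : IsSigmaFour S) : IsSigmaZero 4 S := by
  obtain ⟨A, hA, rfl⟩ := h
  exact .iUnion 4 A (fun _ => 3) (by simp) fun i => (hA i).isSigmaZero_compl

lemma IsSigmaZero.isOpen {S : Set X} (h : IsSigmaZero 1 S) : IsOpen S := by
  cases h with
  | of_isOpen _ hU => exact hU
  | iUnion _ A m hm hA => exact absurd (hm 0) (by omega)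

lemma IsSigmaZero.isFSigma {S : Set X} (h : IsSigmaZero 2 S) : IsFSigma S := by
  cases h with
  | iUnion _ A m hm hA =>
    refine ⟨A, fun i => ?_, rfl⟩
    have h1 : m i = 1 := by have := hm i; omega
    have := hA i
    rw [h1] at this
    exact isOpen_compl_iff.1 this.isOpen

lemma IsSigmaZero.isFSigma_of_le_two [TopologicalSpace.PseudoMetrizableSpace X] {S : Set X}
    {m : ℕ} (hm : 1 ≤ m) (hm' : m ≤ 2) (h : IsSigmaZero m S) : IsFSigma S := by
  interval_cases m
  · exact .of_isOpen h.isOpen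
  · exact h.isFSigma

lemma IsSigmaZero.isPiThree_of_compl [TopologicalSpace.PseudoMetrizableSpace X] {S : Set X}
    {m : ℕ} (hm : 1 ≤ m) (hm' : m ≤ 3) (h : IsSigmaZero m Sᶜ) : IsPiThree S := by
  rcases hm'.lt_or_eq with hlt | rfl
  · obtain ⟨C, hC, hS⟩ := h.isFSigma_of_le_two hm (by omega)
    refine ⟨fun i => (C i)ᶜ, fun i => .of_isOpen (hC i).isOpen_compl, ?_⟩
    rw [← Set.compl_iUnion, ← hS, compl_compl]
  · generalize hT : Sᶜ = T at h
    cases h with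
    | iUnion _ A m hm hA =>
      refine ⟨fun i => (A i)ᶜ, fun i => ?_, ?_⟩
      · have := hm i
        exact (hA i).isFSigma_of_le_two this.1 (by omega)
      · rw [← Set.compl_iUnion, ← hT, compl_compl]

lemma IsSigmaZero.isSigmaFour [TopologicalSpace.PseudoMetrizableSpace X] {S : Set X}
    (h : IsSigmaZero 4 S) : IsSigmaFour S := by
  cases h with
  | iUnion _ A m hm hA =>
    refine ⟨A, fun i => ?_, rfl⟩
    have := hm i
    exact (hA i).isPiThree_of_compl this.1 (by omega)

end NormalForms

open Set Filter Topology

/-! ### Solutions on compact time intervals -/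

/-- `ψ` solves `ψ' = F (t, ψ)`, `ψ 0 = 0` on the time interval `[0, T]`, written as an integral
equation. The values of `ψ` outside `[0, T]` are irrelevant. -/
def IsPath (F : C(ℝ × ℝ, ℝ)) (T : ℝ) (ψ : C(ℝ, ℝ)) : Prop :=
  ∀ s ∈ Icc 0 T, ψ s = ∫ u in (0 : ℝ)..s, F (u, ψ u)

/-- The right hand sides `F` for which `ψ' = F (t, ψ)`, `ψ 0 = 0` has a solution on `[0, ∞)`. -/
def rightSolvable : Set C(ℝ × ℝ, ℝ) :=
  {F | ∃ ψ : C(ℝ, ℝ), ∀ T, IsPath F T ψ}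

/-- The right hand side of the equation solved by the functions `-ψ`. -/
def reflect (F : C(ℝ × ℝ, ℝ)) : C(ℝ × ℝ, ℝ) :=
  ⟨fun p => -F (p.1, -p.2), by fun_prop⟩

@[simp] lemma reflect_apply (F : C(ℝ × ℝ, ℝ)) (p : ℝ × ℝ) : reflect F p = -F (p.1, -p.2) := rfl

@[simp] lemma reflect_reflect (F : C(ℝ × ℝ, ℝ)) : reflect (reflect F) = F := by
  ext p; simp

lemma continuous_reflect : Continuous reflect := by
  have h : reflect = fun F : C(ℝ × ℝ, ℝ) =>
      -(F.comp (⟨fun p => (p.1, -p.2), by fun_prop⟩ : C(ℝ × ℝ, ℝ × ℝ))) := by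
    ext F p; rfl
  rw [h]
  exact (ContinuousMap.continuous_precomp _).neg

section Paths

variable {F : C(ℝ × ℝ, ℝ)} {T T' t : ℝ} {ψ γ : C(ℝ, ℝ)}

lemma IsPath.mono (h : IsPath F T ψ) (hT : T' ≤ T) : IsPath F T' ψ :=
  fun s hs => h s ⟨hs.1, hs.2.trans hT⟩

lemma IsPath.map_zero (h : IsPath F T ψ) (hT : 0 ≤ T) : ψ 0 = 0 := by
  simpa using h 0 ⟨le_rfl, hT⟩

lemma IsPath.congr (h : IsPath F T ψ) (h' : ∀ s ∈ Icc 0 T, γ s = ψ s) : IsPath F T γ := by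
  intro s hs
  rw [h' s hs, h s hs]
  refine intervalIntegral.integral_congr fun u hu => ?_
  rw [uIcc_of_le hs.1] at hu
  simp only [h' u ⟨hu.1, hu.2.trans hs.2⟩]

lemma continuous_field_comp (F : C(ℝ × ℝ, ℝ)) (ψ : C(ℝ, ℝ)) :
    Continuous fun u => F (u, ψ u) := by fun_prop

lemma IsPath.eq_add_integral (h : IsPath F T ψ) {r s : ℝ} (hr : r ∈ Icc 0 T)
    (hs : s ∈ Icc 0 T) : ψ s = ψ r + ∫ u in r..s, F (u, ψ u) := by
  rw [h s hs, h r hr, intervalIntegral.integral_add_adjacent_intervals] <;>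
  exact (continuous_field_comp F ψ).intervalIntegrable _ _

lemma isPath_reflect_neg : IsPath (reflect F) T (-ψ) ↔ IsPath F T ψ := by
  refine forall₂_congr fun s _ => ?_
  simp [intervalIntegral.integral_neg]

lemma isPath_reflect : IsPath (reflect F) T ψ ↔ IsPath F T (-ψ) := by
  rw [← isPath_reflect_neg (F := F), neg_neg]

lemma reflect_mem_rightSolvable : reflect F ∈ rightSolvable ↔ F ∈ rightSolvable := by
  constructor
  · rintro ⟨ψ, h⟩
    exact ⟨-ψ, fun T => isPath_reflect.1 (h T)⟩
  · rintro ⟨ψ, h⟩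
    exact ⟨-ψ, fun T => isPath_reflect_neg.2 (h T)⟩

/-- A solution on `[0, t]` is continued by a solution on `[t, T]`. -/
lemma IsPath.append (h : IsPath F t ψ) (ht : 0 ≤ t) (htT : t ≤ T) {σ : ℝ → ℝ}
    (hσ : ContinuousOn σ (Icc t T)) (h0 : σ t = ψ t)
    (hint : ∀ s ∈ Icc t T, σ s = σ t + ∫ u in t..s, F (u, σ u)) :
    ∃ ψ' : C(ℝ, ℝ), IsPath F T ψ' ∧ (∀ s ≤ t, ψ' s = ψ s) ∧ ∀ s ∈ Icc t T, ψ' s = σ s := by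
  let ρ : ℝ → ℝ := fun s => σ (projIcc t T htT s)
  have hρ : Continuous ρ := hσ.domRestrict.comp continuous_projIcc
  have hρ1 : ∀ s ≤ t, ρ s = σ t := fun s hs => by simp [ρ, projIcc_of_le_left htT hs]
  have hρ2 : ∀ s ∈ Icc t T, ρ s = σ s := fun s hs => by simp [ρ, projIcc_of_mem htT hs]
  let ψ' : C(ℝ, ℝ) := ⟨fun s => ψ (min s t) + (ρ s - σ t), by fun_prop⟩
  have h1 : ∀ s ≤ t, ψ' s = ψ s := fun s hs => by
    simp [ψ', hρ1 s hs, min_eq_left hs]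
  have h2 : ∀ s ∈ Icc t T, ψ' s = σ s := fun s hs => by
    simp [ψ', hρ2 s hs, min_eq_right hs.1, h0]
  have h3 : IsPath F t ψ' := h.congr fun s hs => h1 s hs.2
  refine ⟨ψ', fun s hs => ?_, h1, h2⟩
  rcases le_total s t with hst | hst
  · exact h3 s ⟨hs.1, hst⟩
  have hc := continuous_field_comp F ψ'
  rw [← intervalIntegral.integral_add_adjacent_intervals (hc.intervalIntegrable 0 t)
    (hc.intervalIntegrable t s), ← h3 t ⟨ht, le_rfl⟩, h2 s ⟨hst, hs.2⟩, hint s ⟨hst, hs.2⟩,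
    h2 t ⟨le_rfl, htT⟩]
  congr 1
  refine intervalIntegral.integral_congr fun u hu => ?_
  rw [uIcc_of_le hst] at hu
  simp only [h2 u ⟨hu.1, hu.2.trans hs.2⟩]

lemma IsPath.glue (h : IsPath F t ψ) (h' : IsPath F T γ) (ht : 0 ≤ t) (htT : t ≤ T)
    (h0 : ψ t = γ t) :
    ∃ ψ' : C(ℝ, ℝ), IsPath F T ψ' ∧ (∀ s ≤ t, ψ' s = ψ s) ∧ ∀ s ∈ Icc t T, ψ' s = γ s :=
  h.append ht htT γ.continuous.continuousOn h0.symm fun _ hs =>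
    h'.eq_add_integral ⟨ht, htT⟩ ⟨ht.trans hs.1, hs.2⟩

lemma IsPath.append_of_hasDerivAt (h : IsPath F t ψ) (ht : 0 ≤ t) (htT : t ≤ T) {σ : ℝ → ℝ}
    (h0 : σ t = ψ t) (hσ : ∀ s ∈ Icc t T, HasDerivAt σ (F (s, σ s)) s) :
    ∃ ψ' : C(ℝ, ℝ), IsPath F T ψ' ∧ (∀ s ≤ t, ψ' s = ψ s) ∧ ∀ s ∈ Icc t T, ψ' s = σ s := by
  have hc : ContinuousOn σ (Icc t T) := fun s hs => (hσ s hs).continuousAt.continuousWithinAt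
  refine h.append ht htT hc h0 fun s hs => ?_
  rw [intervalIntegral.integral_eq_sub_of_hasDerivAt]
  · ring
  · intro u hu
    rw [uIcc_of_le hs.1] at hu
    exact hσ u ⟨hu.1, hu.2.trans hs.2⟩
  · refine ContinuousOn.intervalIntegrable ?_
    rw [uIcc_of_le hs.1]
    exact F.continuous.comp_continuousOn
      (continuousOn_id.prodMk (hc.mono (Icc_subset_Icc_right hs.2)))

/-- Stationary points extend solutions. -/
lemma IsPath.append_const (h : IsPath F t ψ) (ht : 0 ≤ t) (htT : t ≤ T)
    (h0 : ∀ s ∈ Icc t T, F (s, ψ t) = 0) :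
    ∃ ψ' : C(ℝ, ℝ), IsPath F T ψ' ∧ (∀ s ≤ t, ψ' s = ψ s) ∧ ∀ s ∈ Icc t T, ψ' s = ψ t :=
  h.append_of_hasDerivAt (σ := fun _ => ψ t) ht htT rfl fun s hs => by
    rw [h0 s hs]; exact hasDerivAt_const s _

lemma exists_field_bound (F : C(ℝ × ℝ, ℝ)) (T C : ℝ) :
    ∃ L, 0 < L ∧ ∀ s ∈ Icc 0 T, ∀ z ∈ Icc (-C) C, |F (s, z)| < L := by
  obtain ⟨L, hL⟩ := (isCompact_Icc.prod isCompact_Icc).exists_bound_of_continuousOn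
    (s := Icc (0 : ℝ) T ×ˢ Icc (-C) C) F.continuous.continuousOn
  refine ⟨|L| + 1, by positivity, fun s hs z hz => ?_⟩
  have := hL (s, z) ⟨hs, hz⟩
  rw [Real.norm_eq_abs] at this
  linarith [le_abs_self L]

lemma exists_path_bound (ψ : C(ℝ, ℝ)) (T : ℝ) : ∃ C, 0 < C ∧ ∀ s ∈ Icc 0 T, |ψ s| < C := by
  obtain ⟨L, hL⟩ := (isCompact_Icc (a := (0 : ℝ)) (b := T)).exists_bound_of_continuousOn
    ψ.continuous.continuousOn
  refine ⟨|L| + 1, by positivity, fun s hs => ?_⟩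
  have := hL s hs
  rw [Real.norm_eq_abs] at this
  linarith [le_abs_self L]

lemma IsPath.abs_sub_le (h : IsPath F T ψ) {L : ℝ} (hL : ∀ s ∈ Icc 0 T, |F (s, ψ s)| ≤ L)
    {r s : ℝ} (hr : r ∈ Icc 0 T) (hs : s ∈ Icc 0 T) : |ψ s - ψ r| ≤ L * |s - r| := by
  rw [h.eq_add_integral hr hs, add_sub_cancel_left]
  rw [← Real.norm_eq_abs]
  exact intervalIntegral.norm_integral_le_of_norm_le_const fun u hu =>
    hL u (uIcc_subset_Icc hr hs (uIoc_subset_uIcc hu))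

/-- A sequence of solutions on longer and longer time intervals that decreases to finite values has
a global solution as its limit. -/
lemma rightSolvable_of_antitone {T : ℕ → ℝ} (hT : Monotone T) (hT' : Tendsto T atTop atTop)
    {χ : ℕ → C(ℝ, ℝ)} (hχ : ∀ n, IsPath F (T n) (χ n))
    (hanti : ∀ n, ∀ s ∈ Icc 0 (T n), χ (n + 1) s ≤ χ n s)
    (hb : ∀ n, ∃ B, ∀ N, n ≤ N → ∀ s ∈ Icc 0 (T n), B ≤ χ N s) : F ∈ rightSolvable := by
  have hle : ∀ n N, n ≤ N → ∀ s ∈ Icc 0 (T n), χ N s ≤ χ n s := by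
    intro n N hN
    induction N, hN using Nat.le_induction with
    | base => exact fun s _ => le_rfl
    | succ N hN ih =>
      exact fun s hs => (hanti N s ⟨hs.1, hs.2.trans (hT hN)⟩).trans (ih s hs)
  have hlim : ∀ s : ℝ, ∃ l, 0 ≤ s → Tendsto (fun N => χ N s) atTop (𝓝 l) := by
    intro s
    by_cases hs : 0 ≤ s
    swap
    · exact ⟨0, fun h => absurd h hs⟩
    obtain ⟨n, hn⟩ := (hT'.eventually_ge_atTop s).exists
    obtain ⟨B, hB⟩ := hb n
    have h1 : Antitone fun k => χ (k + n) s := antitone_nat_of_succ_le fun k => by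
      rw [Nat.add_right_comm]
      exact hanti (k + n) s ⟨hs, hn.trans (hT (by omega))⟩
    have h2 : BddBelow (range fun k => χ (k + n) s) :=
      ⟨B, by rintro _ ⟨k, rfl⟩; exact hB _ (by omega) s ⟨hs, hn⟩⟩
    exact ⟨_, fun _ => (tendsto_add_atTop_iff_nat n).1 (tendsto_atTop_ciInf h1 h2)⟩
  choose l hl using hlim
  have hbox : ∀ n, ∃ L, ∀ N, n ≤ N → ∀ s ∈ Icc 0 (T n), |F (s, χ N s)| ≤ L := by
    intro n
    obtain ⟨B, hB⟩ := hb n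
    obtain ⟨C, -, hC⟩ := exists_path_bound (χ n) (T n)
    obtain ⟨L, -, hL⟩ := exists_field_bound F (T n) (max (-B) C)
    refine ⟨L, fun N hN s hs => (hL s hs _ ⟨?_, ?_⟩).le⟩
    · have := hB N hN s hs
      linarith [le_max_left (-B) C]
    · exact (hle n N hN s hs).trans ((le_abs_self _).trans ((hC s hs).le.trans (le_max_right _ _)))
  have hcont : ContinuousOn l (Ici 0) := by
    intro s hs
    obtain ⟨n, hn⟩ := (hT'.eventually_gt_atTop s).exists
    obtain ⟨L, hL⟩ := hbox n
    have hlip : LipschitzOnWith (Real.toNNReal L) l (Icc 0 (T n)) := by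
      refine LipschitzOnWith.of_dist_le_mul fun a ha b hb => ?_
      have h1 : Tendsto (fun N => dist (χ N a) (χ N b)) atTop (𝓝 (dist (l a) (l b))) :=
        (hl a ha.1).dist (hl b hb.1)
      refine le_of_tendsto h1 ?_
      filter_upwards [eventually_ge_atTop n] with N hN
      have h2 := ((hχ N).mono (hT hN)).abs_sub_le (hL N hN) hb ha
      rw [Real.dist_eq, Real.dist_eq]
      exact h2.trans (mul_le_mul_of_nonneg_right (Real.le_coe_toNNReal L) (abs_nonneg _))
    refine (hlip.continuousOn s ⟨hs, hn.le⟩).mono_of_mem_nhdsWithin ?_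
    rw [← Ici_inter_Iic]
    exact inter_mem self_mem_nhdsWithin (mem_nhdsWithin_of_mem_nhds (Iic_mem_nhds hn))
  refine ⟨⟨fun s => l (max s 0), hcont.comp_continuous (by fun_prop)
    fun s => mem_Ici.2 (le_max_right _ _)⟩, fun S s hs => ?_⟩
  obtain ⟨n, hn⟩ := (hT'.eventually_ge_atTop s).exists
  obtain ⟨L, hL⟩ := hbox n
  have h1 : Tendsto (fun N => ∫ u in (0 : ℝ)..s, F (u, χ N u)) atTop
      (𝓝 (∫ u in (0 : ℝ)..s, F (u, l (max u 0)))) := by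
    refine intervalIntegral.tendsto_integral_filter_of_dominated_convergence (fun _ => L)
      ?_ ?_ ?_ ?_
    · exact Eventually.of_forall fun N => (continuous_field_comp F (χ N)).aestronglyMeasurable
    · filter_upwards [eventually_ge_atTop n] with N hN
      refine Eventually.of_forall fun u hu => ?_
      rw [uIoc_of_le hs.1] at hu
      exact hL N hN u ⟨hu.1.le, hu.2.trans hn⟩
    · exact intervalIntegrable_const
    · refine Eventually.of_forall fun u hu => ?_
      rw [uIoc_of_le hs.1] at hu
      rw [max_eq_left hu.1.le]
      exact (F.continuous.tendsto (u, l u)).comp (tendsto_const_nhds.prodMk_nhds (hl u hu.1.le))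
  refine tendsto_nhds_unique (f := fun N => χ N s) (l := atTop) ?_ ?_
  · simpa [max_eq_left hs.1] using hl s hs.1
  · refine h1.congr' ?_
    filter_upwards [eventually_ge_atTop n] with N hN
    exact (hχ N s ⟨hs.1, hn.trans (hT hN)⟩).symm

/-- Solutions on longer and longer time intervals that extend each other combine to a global
solution. -/
lemma rightSolvable_of_extensions {T : ℕ → ℝ} (hT : Monotone T) (hT' : Tendsto T atTop atTop)
    {χ : ℕ → C(ℝ, ℝ)} (hχ : ∀ n, IsPath F (T n) (χ n))
    (hext : ∀ n, ∀ s ≤ T n, χ (n + 1) s = χ n s) : F ∈ rightSolvable := by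
  have heq : ∀ n N, n ≤ N → ∀ s ≤ T n, χ N s = χ n s := by
    intro n N hN
    induction N, hN using Nat.le_induction with
    | base => exact fun s _ => rfl
    | succ N hN ih => exact fun s hs => (hext N s (hs.trans (hT hN))).trans (ih s hs)
  refine rightSolvable_of_antitone hT hT' hχ (fun n s hs => (hext n s hs.2).le) fun n => ?_
  obtain ⟨C, hC0, hC⟩ := exists_path_bound (χ n) (T n)
  refine ⟨-C, fun N hN s hs => ?_⟩
  rw [heq n N hN s hs.2]
  exact (abs_lt.1 (hC s hs)).1.le

end Paths

/-! ### Compactness of families of solutions and Peano's theorem -/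

/-- The functions with value `0` at `0` and Lipschitz constant `L`. -/
def lipschitzFunctions (L : ℝ) : Set C(ℝ, ℝ) :=
  {ψ | ψ 0 = 0 ∧ ∀ r s, |ψ s - ψ r| ≤ L * |s - r|}

lemma isCompact_lipschitzFunctions (L : ℝ) : IsCompact (lipschitzFunctions L) := by
  have hlip : ∀ f : ℝ → ℝ, (∀ r s, |f s - f r| ≤ L * |s - r|) → LipschitzWith L.toNNReal f := by
    intro f hf
    refine LipschitzWith.of_dist_le_mul fun a b => ?_
    rw [Real.dist_eq, Real.dist_eq]
    exact (hf b a).trans (mul_le_mul_of_nonneg_right (Real.le_coe_toNNReal L) (abs_nonneg _))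
  refine ArzelaAscoli.isCompact_of_equicontinuous _ ?_ ?_
  · have himage : ContinuousMap.toFun '' lipschitzFunctions L =
        {f : ℝ → ℝ | f 0 = 0 ∧ ∀ r s, |f s - f r| ≤ L * |s - r|} := by
      ext f
      constructor
      · rintro ⟨ψ, hψ, rfl⟩
        exact hψ
      · intro hf
        exact ⟨⟨f, (hlip f hf.2).continuous⟩, hf, rfl⟩
    rw [himage]
    refine (isCompact_univ_pi fun s : ℝ => isCompact_Icc (a := -(L * |s|))
      (b := L * |s|)).of_isClosed_subset ?_ ?_
    · have h1 : IsClosed {f : ℝ → ℝ | f 0 = 0} :=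
        isClosed_eq (continuous_apply _) continuous_const
      have h2 : IsClosed {f : ℝ → ℝ | ∀ r s, |f s - f r| ≤ L * |s - r|} := by
        simp only [ofPred_forall]
        exact isClosed_iInter fun r => isClosed_iInter fun s =>
          isClosed_le (by fun_prop) continuous_const
      exact h1.inter h2
    · intro f hf s _
      have := hf.2 0 s
      rw [hf.1, sub_zero, sub_zero] at this
      exact abs_le.1 this
  · refine (LipschitzWith.uniformEquicontinuous _ L.toNNReal fun ψ => ?_).equicontinuous
    exact hlip _ ψ.2.2

lemma isClosed_exists_mem_of_isCompact {X Y : Type*} [TopologicalSpace X] [TopologicalSpace Y]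
    {C : Set Y} (hC : IsCompact C) {Z : Set (X × Y)} (hZ : IsClosed Z) :
    IsClosed {x | ∃ y ∈ C, (x, y) ∈ Z} := by
  have : CompactSpace C := isCompact_iff_compactSpace.1 hC
  have h := isClosedMap_fst_of_compactSpace (X := X) (Y := C) _
    (hZ.preimage (f := fun p : X × C => (p.1, (p.2 : Y))) (by fun_prop))
  convert h using 1
  ext x
  simp

/-- The pairs `(F, z)` for which some solution on a time interval `[0, T]`, `a ≤ T ≤ b`, satisfies
prescribed bounds on `[0, K]` and on `[0, T]` and a prescribed condition at the end point. -/
def boundedPathSet (K a b : ℝ) (I J : Set ℝ) (Q : Set (ℝ × ℝ)) : Set (C(ℝ × ℝ, ℝ) × ℝ) :=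
  {p | ∃ T ∈ Icc a b, ∃ ψ, IsPath p.1 T ψ ∧ (∀ s ∈ Icc 0 K, ψ s ∈ I) ∧
    (∀ s ∈ Icc 0 T, ψ s ∈ J) ∧ (ψ T, p.2) ∈ Q}

/-- A field with a point, and a time with a function. -/
abbrev FieldPath : Type := (C(ℝ × ℝ, ℝ) × ℝ) × (ℝ × C(ℝ, ℝ))

/-- The solutions of a field near `F₀` that stay in a bounded region have a common Lipschitz
constant, hence form a compact family, and the integral equation is a closed condition. -/
lemma isClosed_boundedPathSet {K a b c d : ℝ} (hK : 0 ≤ K) (hKa : K ≤ a) {I : Set ℝ}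
    (hI : IsClosed I) {Q : Set (ℝ × ℝ)} (hQ : IsClosed Q) :
    IsClosed (boundedPathSet K a b I (Icc c d) Q) := by
  refine isClosed_of_closure_subset fun p₀ hp₀ => ?_
  set C := max (-c) d
  obtain ⟨L, hL0, hL⟩ := exists_field_bound p₀.1 b C
  let U : Set (C(ℝ × ℝ, ℝ) × ℝ) :=
    {p | MapsTo p.1 (Icc (0 : ℝ) b ×ˢ Icc (-C) C) (Ioo (-L) L)}
  have hU : IsOpen U := (ContinuousMap.isOpen_setOfPred_mapsTo
    (isCompact_Icc.prod isCompact_Icc) isOpen_Ioo).preimage continuous_fst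
  have hpU : p₀ ∈ U := fun q hq => abs_lt.1 (hL q.1 hq.1 q.2 hq.2)
  have hZ1 : IsClosed {q : FieldPath | ∀ s ∈ Icc 0 b, q.2.2 (min s q.2.1) =
      ∫ u in (0 : ℝ)..(min s q.2.1), q.1.1 (u, q.2.2 u)} := by
    simp only [ofPred_forall]
    refine isClosed_iInter fun s => isClosed_iInter fun _ => isClosed_eq (by fun_prop) ?_
    refine intervalIntegral.continuous_parametric_intervalIntegral_of_continuous
      (f := fun (q : FieldPath) u => q.1.1 (u, q.2.2 u)) ?_ (by fun_prop)
    simp only [Function.uncurry_def]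
    fun_prop
  have hZ2 : IsClosed {q : FieldPath | ∀ s ∈ Icc 0 K, q.2.2 s ∈ I} := by
    simp only [ofPred_forall]
    exact isClosed_iInter fun s => isClosed_iInter fun _ =>
      hI.preimage (f := fun q : FieldPath => q.2.2 s) (by fun_prop)
  have hZ3 : IsClosed {q : FieldPath | ∀ s ∈ Icc 0 b, q.2.2 (min s q.2.1) ∈ Icc c d} := by
    simp only [ofPred_forall]
    exact isClosed_iInter fun s => isClosed_iInter fun _ =>
      isClosed_Icc.preimage (f := fun q : FieldPath => q.2.2 (min s q.2.1)) (by fun_prop)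
  have hZ4 : IsClosed {q : FieldPath | (q.2.2 q.2.1, q.1.2) ∈ Q} :=
    hQ.preimage (f := fun q : FieldPath => (q.2.2 q.2.1, q.1.2)) (by fun_prop)
  have hSL := isClosed_exists_mem_of_isCompact
    ((isCompact_Icc (a := a) (b := b)).prod (isCompact_lipschitzFunctions L))
    (((hZ1.inter hZ2).inter hZ3).inter hZ4)
  suffices h : p₀ ∈ {x | ∃ y ∈ Icc a b ×ˢ lipschitzFunctions L, (x, y) ∈ (({q : FieldPath |
      ∀ s ∈ Icc 0 b, q.2.2 (min s q.2.1) = ∫ u in (0 : ℝ)..(min s q.2.1), q.1.1 (u, q.2.2 u)} ∩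
      {q : FieldPath | ∀ s ∈ Icc 0 K, q.2.2 s ∈ I}) ∩
        {q : FieldPath | ∀ s ∈ Icc 0 b, q.2.2 (min s q.2.1) ∈ Icc c d})
      ∩ {q : FieldPath | (q.2.2 q.2.1, q.1.2) ∈ Q}} by
    obtain ⟨⟨T, ψ⟩, ⟨hT, -⟩, ⟨⟨h0, h1⟩, h2⟩, h3⟩ := h
    refine ⟨T, hT, ψ, fun s hs => ?_, h1, fun s hs => ?_, h3⟩
    · simpa [min_eq_left hs.2] using h0 s ⟨hs.1, hs.2.trans hT.2⟩
    · simpa [min_eq_left hs.2] using h2 s ⟨hs.1, hs.2.trans hT.2⟩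
  refine closure_minimal ?_ hSL (hU.inter_closure ⟨hpU, hp₀⟩)
  rintro p ⟨hp, T, hT, ψ, hψ, h1, h2, h3⟩
  have hT0 : 0 ≤ T := hK.trans (hKa.trans hT.1)
  -- stopping the solution at the times `0` and `T` makes it globally Lipschitz
  let ψ' : C(ℝ, ℝ) := ⟨fun s => ψ (projIcc 0 T hT0 s), by fun_prop⟩
  have hψ' : ∀ s ∈ Icc 0 T, ψ' s = ψ s := fun s hs => by simp [ψ', projIcc_of_mem hT0 hs]
  have hpath : IsPath p.1 T ψ' := hψ.congr hψ'
  have hmin : ∀ s ∈ Icc 0 b, min s T ∈ Icc 0 T := fun s hs =>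
    ⟨le_min hs.1 hT0, min_le_right _ _⟩
  refine ⟨(T, ψ'), ⟨hT, hpath.map_zero hT0, fun r s => ?_⟩, ⟨⟨fun s hs => ?_, fun s hs => ?_⟩,
    fun s hs => ?_⟩, ?_⟩
  · have h4 := hψ.abs_sub_le (L := L) (fun s hs => ?_) (projIcc 0 T hT0 r).2
      (projIcc 0 T hT0 s).2
    · refine h4.trans (mul_le_mul_of_nonneg_left ?_ hL0.le)
      have h5 := (LipschitzWith.projIcc hT0).dist_le_mul s r
      simpa [Real.dist_eq, Subtype.dist_eq] using h5
    · refine (abs_lt.2 (hp ⟨⟨hs.1, hs.2.trans hT.2⟩, ?_, ?_⟩)).le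
      · have := (h2 s hs).1
        have := le_max_left (-c) d
        simp only [C]; linarith
      · exact (h2 s hs).2.trans (le_max_right _ _)
  · exact hpath _ (hmin s hs)
  · change ψ' s ∈ I
    rw [hψ' s ⟨hs.1, hs.2.trans (hKa.trans hT.1)⟩]; exact h1 s hs
  · change ψ' (min s T) ∈ Icc c d
    rw [hψ' _ (hmin s hs)]; exact h2 _ (hmin s hs)
  · change (ψ' T, p.2) ∈ Q
    rw [hψ' T ⟨hT0, le_rfl⟩]; exact h3

/-- Averages of `F` in the space direction over intervals of length `ε`. For `ε ≠ 0` they are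
Lipschitz in space if `F` is bounded. -/
noncomputable def spaceAverage (F : C(ℝ × ℝ, ℝ)) (ε : ℝ) : C(ℝ × ℝ, ℝ) :=
  ⟨fun p => ∫ w in (0 : ℝ)..1, F (p.1, p.2 + ε * w),
    intervalIntegral.continuous_parametric_intervalIntegral_of_continuous'
      (f := fun (p : ℝ × ℝ) w => F (p.1, p.2 + ε * w))
      (by simp only [Function.uncurry_def]; fun_prop) 0 1⟩

lemma continuous_spaceAverage (F : C(ℝ × ℝ, ℝ)) : Continuous (spaceAverage F) := by
  refine ContinuousMap.continuous_of_continuous_uncurry _ ?_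
  exact intervalIntegral.continuous_parametric_intervalIntegral_of_continuous'
      (f := fun (q : ℝ × ℝ × ℝ) w => F (q.2.1, q.2.2 + q.1 * w))
      (by simp only [Function.uncurry_def]; fun_prop) 0 1

lemma spaceAverage_zero (F : C(ℝ × ℝ, ℝ)) : spaceAverage F 0 = F := by
  ext p
  simp [spaceAverage]

lemma abs_spaceAverage_le {F : C(ℝ × ℝ, ℝ)} {L : ℝ} (hL : ∀ p, |F p| ≤ L) (ε : ℝ) (p : ℝ × ℝ) :
    |spaceAverage F ε p| ≤ L := by
  have := intervalIntegral.norm_integral_le_of_norm_le_const (a := (0 : ℝ)) (b := 1) (C := L)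
    (f := fun w => F (p.1, p.2 + ε * w)) fun w _ => hL _
  simpa [spaceAverage] using this

lemma abs_spaceAverage_sub_le {F : C(ℝ × ℝ, ℝ)} {L : ℝ} (hL : ∀ p, |F p| ≤ L) {ε : ℝ}
    (hε : ε ≠ 0) (t x y : ℝ) :
    |spaceAverage F ε (t, x) - spaceAverage F ε (t, y)| ≤ |ε|⁻¹ * (2 * L) * |x - y| := by
  have hc : Continuous fun v => F (t, v) := by fun_prop
  have hi : ∀ a b, IntervalIntegrable (fun v => F (t, v)) MeasureTheory.volume a b :=
    fun a b => hc.intervalIntegrable a b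
  have h1 : ∀ z, spaceAverage F ε (t, z) = ε⁻¹ * ∫ v in z..(z + ε), F (t, v) := by
    intro z
    have := intervalIntegral.integral_comp_add_mul (a := 0) (b := 1) (fun v => F (t, v)) hε z
    simpa [spaceAverage] using this
  have h2 : ∫ v in x..(x + ε), F (t, v) =
      (∫ v in x..y, F (t, v)) + (∫ v in y..(y + ε), F (t, v)) +
        ∫ v in (y + ε)..(x + ε), F (t, v) := by
    rw [intervalIntegral.integral_add_adjacent_intervals (hi _ _) (hi _ _),
      intervalIntegral.integral_add_adjacent_intervals (hi _ _) (hi _ _)]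
  have h3 := intervalIntegral.norm_integral_le_of_norm_le_const (a := x) (b := y) (C := L)
    (f := fun v => F (t, v)) fun v _ => hL _
  have h4 := intervalIntegral.norm_integral_le_of_norm_le_const (a := y + ε) (b := x + ε) (C := L)
    (f := fun v => F (t, v)) fun v _ => hL _
  rw [Real.norm_eq_abs] at h3 h4
  rw [add_sub_add_right_eq_sub] at h4
  rw [abs_sub_comm] at h3
  rw [h1, h1, h2, ← mul_sub, abs_mul, abs_inv, mul_assoc]
  refine mul_le_mul_of_nonneg_left ?_ (by positivity)
  rw [show ∀ A B C : ℝ, A + B + C - B = A + C by intros; ring]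
  refine (abs_add_le _ _).trans ?_
  linarith

/-- **Peano's theorem** for a bounded right hand side. It is approximated by fields that are
Lipschitz in space, whose solutions form a relatively compact family. -/
lemma exists_isPath_of_bounded {F : C(ℝ × ℝ, ℝ)} {L T : ℝ} (hT : 0 ≤ T) (hL : ∀ p, |F p| ≤ L) :
    ∃ ψ, IsPath F T ψ := by
  have hL0 : 0 ≤ L := (abs_nonneg _).trans (hL 0)
  have hS : IsClosed (boundedPathSet 0 T T univ (Icc (-(L * T)) (L * T)) univ) :=
    isClosed_boundedPathSet le_rfl hT isClosed_univ isClosed_univ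
  have hcl : IsClosed {ε : ℝ | (spaceAverage F ε, (0 : ℝ)) ∈
      boundedPathSet 0 T T univ (Icc (-(L * T)) (L * T)) univ} :=
    hS.preimage ((continuous_spaceAverage F).prodMk continuous_const)
  have hsub : ({0}ᶜ : Set ℝ) ⊆ {ε : ℝ | (spaceAverage F ε, (0 : ℝ)) ∈
      boundedPathSet 0 T T univ (Icc (-(L * T)) (L * T)) univ} := by
    intro ε hε
    set G := spaceAverage F ε
    have hG : ∀ p, |G p| ≤ L := abs_spaceAverage_le hL ε
    have hpl : IsPicardLindelof (fun t z => G (t, z)) (⟨0, le_rfl, hT⟩ : Icc (0 : ℝ) T) 0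
        (L.toNNReal * T.toNNReal) 0 L.toNNReal (|ε|⁻¹ * (2 * L)).toNNReal := by
      refine ⟨fun t _ => ?_, fun z _ => ?_, fun t _ z _ => ?_, ?_⟩
      · refine LipschitzOnWith.of_dist_le_mul fun x _ y _ => ?_
        rw [Real.dist_eq, Real.dist_eq, Real.coe_toNNReal _ (by positivity)]
        exact abs_spaceAverage_sub_le hL hε t x y
      · exact (by fun_prop : Continuous fun t => G (t, z)).continuousOn
      · rw [Real.coe_toNNReal _ hL0]
        exact hG _
      · simp [hT, Real.coe_toNNReal _ hL0, Real.coe_toNNReal _ hT]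
    obtain ⟨α, h0, hα⟩ := hpl.exists_eq_forall_mem_Icc_hasDerivWithinAt₀
    have hαc : ContinuousOn α (Icc 0 T) := fun s hs => (hα s hs).continuousWithinAt
    have hzero : IsPath G 0 0 := by
      intro s hs
      obtain rfl : s = 0 := le_antisymm hs.2 hs.1
      simp
    obtain ⟨ψ, hψ, -, -⟩ := hzero.append (σ := α) le_rfl hT hαc (by simpa using h0) (by
      intro s hs
      have hsub : uIcc 0 s ⊆ Icc 0 T := by
        rw [uIcc_of_le hs.1]; exact Icc_subset_Icc_right hs.2
      exact (ODE.picard_eq_of_hasDerivAt (f := fun t z => G (t, z)) (u := univ) (t₀ := 0)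
        (by simp only [Function.uncurry_def]; fun_prop)
        (fun r hr => (hα r (hsub hr)).mono hsub) (mapsTo_univ _ _)).symm)
    refine ⟨T, ⟨le_rfl, le_rfl⟩, ψ, hψ, fun _ _ => mem_univ _, fun s hs => ?_, mem_univ _⟩
    have h1 := hψ.abs_sub_le (fun s _ => hG (s, ψ s)) (r := 0) ⟨le_rfl, hT⟩ hs
    rw [hψ.map_zero hT, sub_zero, sub_zero, abs_of_nonneg hs.1] at h1
    exact abs_le.1 (h1.trans (mul_le_mul_of_nonneg_left hs.2 hL0))
  have h0 : (0 : ℝ) ∈ {ε : ℝ | (spaceAverage F ε, (0 : ℝ)) ∈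
      boundedPathSet 0 T T univ (Icc (-(L * T)) (L * T)) univ} :=
    closure_minimal hsub hcl ((dense_compl_singleton (0 : ℝ)) 0)
  obtain ⟨T', hT', ψ, hψ, -⟩ := h0
  obtain rfl : T' = T := le_antisymm hT'.2 hT'.1
  rw [spaceAverage_zero] at hψ
  exact ⟨ψ, hψ⟩

/-! ### Extension and crossing of solutions -/

section Extension

variable {F : C(ℝ × ℝ, ℝ)} {T t M : ℝ} {ψ γ : C(ℝ, ℝ)}

/-- A solution extends until it leaves a prescribed bounded region. -/
lemma IsPath.exists_extension (h : IsPath F t ψ) (ht : 0 ≤ t) (htT : t ≤ T) (hM : |ψ t| ≤ M) :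
    ∃ T' ∈ Icc t T, ∃ ψ', IsPath F T' ψ' ∧ (∀ s ≤ t, ψ' s = ψ s) ∧
      (∀ s ∈ Icc t T', |ψ' s| ≤ M) ∧ (T' = T ∨ |ψ' T'| = M) := by
  have hM0 : 0 ≤ M := (abs_nonneg _).trans hM
  have hT : 0 ≤ T := ht.trans htT
  -- the translate of the field to `(t, ψ t)`, cut off outside `[0, T] × [-M, M]`
  let G : C(ℝ × ℝ, ℝ) := ⟨fun p => F (max 0 (min (p.1 + t) T), max (-M) (min (p.2 + ψ t) M)),
    by fun_prop⟩
  obtain ⟨L, hL0, hL⟩ := exists_field_bound F T M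
  have hG : ∀ p, |G p| ≤ L := fun p => (hL _ ⟨le_max_left _ _, max_le hT (min_le_right _ _)⟩ _
    ⟨le_max_left _ _, max_le (by linarith) (min_le_right _ _)⟩).le
  obtain ⟨ρ, hρ⟩ := exists_isPath_of_bounded (T := T - t) (by linarith) hG
  let σ : C(ℝ, ℝ) := ⟨fun s => ψ t + ρ (s - t), by fun_prop⟩
  have hσt : σ t = ψ t := by simp [σ, hρ.map_zero (by linarith)]
  obtain ⟨T', hT', hb, hend⟩ : ∃ T' ∈ Icc t T, (∀ s ∈ Icc t T', |σ s| ≤ M) ∧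
      (T' = T ∨ |σ T'| = M) := by
    by_cases hne : ({s ∈ Icc t T | M ≤ |σ s|}).Nonempty
    · have hcomp : IsCompact {s ∈ Icc t T | M ≤ |σ s|} :=
        isCompact_Icc.inter_right (isClosed_le continuous_const σ.continuous.abs)
      obtain ⟨c, ⟨hc, hcM⟩, hmin⟩ := hcomp.exists_isLeast hne
      obtain ⟨s, hs, hsM⟩ := intermediate_value_Icc (f := fun s => |σ s|) hc.1
        σ.continuous.abs.continuousOn ⟨by rw [hσt]; exact hM, hcM⟩
      have hsc : s = c := le_antisymm hs.2 (hmin ⟨⟨hs.1, hs.2.trans hc.2⟩, hsM.ge⟩)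
      replace hsM : |σ c| = M := hsc ▸ hsM
      refine ⟨c, hc, fun r hr => ?_, Or.inr hsM⟩
      by_contra hlt
      have := hmin ⟨⟨hr.1, hr.2.trans hc.2⟩, (not_le.1 hlt).le⟩
      rw [le_antisymm hr.2 this, hsM] at hlt
      exact hlt le_rfl
    · refine ⟨T, ⟨htT, le_rfl⟩, fun s hs => ?_, Or.inl rfl⟩
      by_contra hlt
      exact hne ⟨s, hs, (not_le.1 hlt).le⟩
  obtain ⟨ψ', h1, h2, h3⟩ := h.append ht hT'.1 σ.continuous.continuousOn hσt (by
    intro s hs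
    rw [hσt]
    change ψ t + ρ (s - t) = _
    rw [hρ (s - t) ⟨by linarith [hs.1], by linarith [hs.2, hT'.2]⟩]
    have := intervalIntegral.integral_comp_sub_right (a := t) (b := s)
      (fun u => G (u, ρ u)) t
    rw [sub_self] at this
    rw [← this]
    congr 1
    refine intervalIntegral.integral_congr fun u hu => ?_
    rw [uIcc_of_le hs.1] at hu
    have hu' : u ∈ Icc t T' := ⟨hu.1, hu.2.trans hs.2⟩
    have h4 := abs_le.1 (hb u hu')
    change F (max 0 (min (u - t + t) T), max (-M) (min (ρ (u - t) + ψ t) M)) = F (u, σ u)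
    rw [add_comm (ρ (u - t)), sub_add_cancel, min_eq_left (hu'.2.trans hT'.2),
      max_eq_right (ht.trans hu'.1)]
    change F (u, max (-M) (min (σ u) M)) = _
    rw [min_eq_left h4.2, max_eq_right h4.1])
  refine ⟨T', hT', ψ', h1, h2, fun s hs => ?_, ?_⟩
  · rw [h3 s hs]; exact hb s hs
  · rw [h3 T' ⟨hT'.1, le_rfl⟩]; exact hend

lemma exists_first_crossing {f g : ℝ → ℝ} {a b : ℝ} (hf : Continuous f) (hg : Continuous g)
    (hab : a ≤ b) (ha : f a ≤ g a) (hb : g b ≤ f b) :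
    ∃ c ∈ Icc a b, f c = g c ∧ ∀ s ∈ Icc a c, f s ≤ g s := by
  have hcomp : IsCompact {s ∈ Icc a b | g s ≤ f s} :=
    isCompact_Icc.inter_right (isClosed_le hg hf)
  obtain ⟨c, ⟨hc, hcM⟩, hmin⟩ := hcomp.exists_isLeast ⟨b, ⟨hab, le_rfl⟩, hb⟩
  have hle : ∀ s ∈ Icc a c, f s ≤ g s := by
    intro s hs
    rcases hs.2.eq_or_lt with rfl | hlt
    · obtain ⟨r, hr, hr0⟩ := intermediate_value_Icc (f := fun s => f s - g s) hc.1
        (by fun_prop) ⟨sub_nonpos.2 ha, sub_nonneg.2 hcM⟩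
      have hr0 : f r - g r = 0 := hr0
      have : r = s := le_antisymm hr.2 (hmin ⟨⟨hr.1, hr.2.trans hc.2⟩, by linarith⟩)
      rw [← this]; linarith
    · by_contra h
      exact absurd (hmin ⟨⟨hs.1, hs.2.trans hc.2⟩, (not_le.1 h).le⟩) (not_le.2 hlt)
  exact ⟨c, hc, le_antisymm (hle c ⟨hc.1, le_rfl⟩) hcM, hle⟩

lemma exists_last_crossing {f g : ℝ → ℝ} {a b : ℝ} (hf : Continuous f) (hg : Continuous g)
    (hab : a ≤ b) (ha : f a ≤ g a) (hb : g b ≤ f b) :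
    ∃ c ∈ Icc a b, f c = g c ∧ ∀ s ∈ Icc c b, g s ≤ f s := by
  obtain ⟨c, hc, h1, h2⟩ := exists_first_crossing (f := fun s => g (-s)) (g := fun s => f (-s))
    (a := -b) (b := -a) (by fun_prop) (by fun_prop) (by linarith) (by simpa using hb)
    (by simpa using ha)
  refine ⟨-c, ⟨by linarith [hc.2], by linarith [hc.1]⟩, h1.symm, fun s hs => ?_⟩
  simpa using h2 (-s) ⟨by linarith [hs.2], by linarith [hs.1]⟩

/-- A solution that is below another one extends without crossing it, until it reaches a
prescribed low level. -/
lemma IsPath.exists_extension_le (h : IsPath F t ψ) (hγ : IsPath F T γ) (ht : 0 ≤ t)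
    (htT : t ≤ T) (hle : ψ t ≤ γ t) (hM : ∀ s ∈ Icc t T, -M ≤ γ s) (hMt : -M ≤ ψ t) :
    ∃ T' ∈ Icc t T, ∃ ψ', IsPath F T' ψ' ∧ (∀ s ≤ t, ψ' s = ψ s) ∧
      (∀ s ∈ Icc t T', -M ≤ ψ' s ∧ ψ' s ≤ γ s) ∧ (T' = T ∨ ψ' T' = -M) := by
  obtain ⟨C, hC0, hC⟩ := exists_path_bound γ T
  have hCt : ∀ s ∈ Icc t T, γ s < C := fun s hs =>
    (le_abs_self _).trans_lt (hC s ⟨ht.trans hs.1, hs.2⟩)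
  obtain ⟨T₁, hT₁, ψ₁, h1, h2, h3, h4⟩ := h.exists_extension (M := max M C) ht htT
    (abs_le.2 ⟨by linarith [le_max_left M C],
      hle.trans ((hCt t ⟨le_rfl, htT⟩).le.trans (le_max_right _ _))⟩)
  have h2t := h2 t le_rfl
  -- the first time `c` at which the extension reaches `γ`, or `T₁`
  obtain ⟨c, hc, hcle, hcend⟩ : ∃ c ∈ Icc t T₁, (∀ s ∈ Icc t c, ψ₁ s ≤ γ s) ∧
      (c = T₁ ∨ ψ₁ c = γ c) := by
    by_cases hcase : ∃ b ∈ Icc t T₁, γ b ≤ ψ₁ b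
    · obtain ⟨b, hb, hb'⟩ := hcase
      obtain ⟨c, hc, hc1, hc2⟩ := exists_first_crossing ψ₁.continuous γ.continuous hb.1
        (by rw [h2t]; exact hle) hb'
      exact ⟨c, ⟨hc.1, hc.2.trans hb.2⟩, hc2, Or.inr hc1⟩
    · push Not at hcase
      exact ⟨T₁, ⟨hT₁.1, le_rfl⟩, fun s hs => (hcase s hs).le, Or.inl rfl⟩
  by_cases hlow : ∃ b ∈ Icc t c, ψ₁ b ≤ -M
  · obtain ⟨b, hb, hb'⟩ := hlow
    obtain ⟨d, hd, hd1, hd2⟩ := exists_first_crossing (f := fun _ => -M) continuous_const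
      ψ₁.continuous hb.1 (by rw [h2t]; exact hMt) hb'
    have hdc : d ≤ c := hd.2.trans hb.2
    exact ⟨d, ⟨hd.1, hdc.trans (hc.2.trans hT₁.2)⟩, ψ₁, h1.mono (hdc.trans hc.2), h2,
      fun s hs => ⟨hd2 s hs, hcle s ⟨hs.1, hs.2.trans hdc⟩⟩, Or.inr hd1.symm⟩
  push Not at hlow
  have hlast : ψ₁ c = γ c → ∃ T' ∈ Icc t T, ∃ ψ', IsPath F T' ψ' ∧ (∀ s ≤ t, ψ' s = ψ s) ∧
      (∀ s ∈ Icc t T', -M ≤ ψ' s ∧ ψ' s ≤ γ s) ∧ (T' = T ∨ ψ' T' = -M) := by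
    intro heq
    obtain ⟨ψ₂, g1, g2, g3⟩ := (h1.mono hc.2).glue hγ (ht.trans hc.1) (hc.2.trans hT₁.2) heq
    refine ⟨T, ⟨htT, le_rfl⟩, ψ₂, g1, fun s hs => ?_, fun s hs => ?_, Or.inl rfl⟩
    · rw [g2 s (hs.trans hc.1), h2 s hs]
    · rcases le_total s c with hsc | hsc
      · rw [g2 s hsc]
        exact ⟨(hlow s ⟨hs.1, hsc⟩).le, hcle s ⟨hs.1, hsc⟩⟩
      · rw [g3 s ⟨hsc, hs.2⟩]
        exact ⟨hM s hs, le_rfl⟩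
  rcases hcend with rfl | heq
  · refine ⟨c, hT₁, ψ₁, h1, h2, fun s hs => ⟨(hlow s hs).le, hcle s hs⟩, ?_⟩
    rcases h4 with h4 | h4
    · exact Or.inl h4
    · exfalso
      have h5 := hlow c ⟨hT₁.1, le_rfl⟩
      have h6 := hcle c ⟨hT₁.1, le_rfl⟩
      have h7 := hCt c hT₁
      have h8 : |ψ₁ c| < max M C := abs_lt.2 ⟨by linarith [le_max_left M C],
        by linarith [le_max_right M C]⟩
      exact absurd h4 h8.ne
  · exact hlast heq

end Extension

/-! ### Solutions that can be driven to infinity -/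

/-- From the position of `ω` at time `K`, solutions reach arbitrarily high levels within a bounded
time. -/
def ReachesUp (F : C(ℝ × ℝ, ℝ)) (K : ℝ) (ω : C(ℝ, ℝ)) : Prop :=
  ∃ n : ℝ, ∀ h : ℝ, ∃ T ∈ Icc K n, ∃ ψ, IsPath F T ψ ∧ (∀ s ≤ K, ψ s = ω s) ∧ h ≤ ψ T

/-- From the position of `ω` at time `K`, solutions reach arbitrarily low levels within a bounded
time. -/
def ReachesDown (F : C(ℝ × ℝ, ℝ)) (K : ℝ) (ω : C(ℝ, ℝ)) : Prop :=
  ∃ n : ℝ, ∀ h : ℝ, ∃ T ∈ Icc K n, ∃ ψ, IsPath F T ψ ∧ (∀ s ≤ K, ψ s = ω s) ∧ ψ T ≤ h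

section Reaches

variable {F : C(ℝ × ℝ, ℝ)} {K T : ℝ} {ω ω' γ : C(ℝ, ℝ)}

lemma ReachesUp.reflect (h : ReachesUp F K ω) : ReachesDown (reflect F) K (-ω) := by
  obtain ⟨n, hn⟩ := h
  refine ⟨n, fun h => ?_⟩
  obtain ⟨T, hT, ψ, h1, h2, h3⟩ := hn (-h)
  refine ⟨T, hT, -ψ, isPath_reflect_neg.2 h1, fun s hs => by simp [h2 s hs], ?_⟩
  simp only [ContinuousMap.coe_neg, Pi.neg_apply]
  linarith

lemma ReachesDown.reflect (h : ReachesDown F K ω) : ReachesUp (reflect F) K (-ω) := by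
  obtain ⟨n, hn⟩ := h
  refine ⟨n, fun h => ?_⟩
  obtain ⟨T, hT, ψ, h1, h2, h3⟩ := hn (-h)
  refine ⟨T, hT, -ψ, isPath_reflect_neg.2 h1, fun s hs => by simp [h2 s hs], ?_⟩
  simp only [ContinuousMap.coe_neg, Pi.neg_apply]
  linarith

lemma reachesDown_reflect_neg : ReachesDown (reflect F) K (-ω) ↔ ReachesUp F K ω :=
  ⟨fun h => by simpa using h.reflect, ReachesUp.reflect⟩

lemma ReachesUp.of_le {n : ℝ} (h : ReachesUp F n γ) (hK : K ≤ n) : ReachesUp F K γ := by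
  obtain ⟨n', hn⟩ := h
  refine ⟨n', fun h => ?_⟩
  obtain ⟨T, hT, ψ, h1, h2, h3⟩ := hn h
  exact ⟨T, ⟨hK.trans hT.1, hT.2⟩, ψ, h1, fun s hs => h2 s (hs.trans hK), h3⟩

lemma ReachesDown.of_le {n : ℝ} (h : ReachesDown F n γ) (hK : K ≤ n) : ReachesDown F K γ := by
  obtain ⟨n', hn⟩ := h
  refine ⟨n', fun h => ?_⟩
  obtain ⟨T, hT, ψ, h1, h2, h3⟩ := hn h
  exact ⟨T, ⟨hK.trans hT.1, hT.2⟩, ψ, h1, fun s hs => h2 s (hs.trans hK), h3⟩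

/-- A solution starting below one that reaches the level `h` from above reaches it as well. -/
lemma IsPath.exists_extension_reaching (hω : IsPath F K ω) (hK : 0 ≤ K) (hγ : IsPath F T γ)
    (hKT : K ≤ T) (hle : ω K ≤ γ K) {h : ℝ} (hT : γ T ≤ h) :
    ∃ T' ∈ Icc K T, ∃ ψ, IsPath F T' ψ ∧ (∀ s ≤ K, ψ s = ω s) ∧ ψ T' ≤ h := by
  rcases le_or_gt (ω K) h with hlow | hhigh
  · exact ⟨K, ⟨le_rfl, hKT⟩, ω, hω, fun _ _ => rfl, hlow⟩
  obtain ⟨c, hc, hc1, hc2⟩ := exists_first_crossing (f := fun _ => h) continuous_const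
    γ.continuous hKT (hhigh.le.trans hle) hT
  obtain ⟨T', hT', ψ, h1, h2, h3, h4⟩ := hω.exists_extension_le (M := -h) (hγ.mono hc.2) hK hc.1
    hle (fun s hs => by simpa using hc2 s hs) (by simpa using hhigh.le)
  refine ⟨T', ⟨hT'.1, hT'.2.trans hc.2⟩, ψ, h1, h2, ?_⟩
  rcases h4 with rfl | h4
  · exact (h3 T' ⟨hT'.1, le_rfl⟩).2.trans hc1.ge
  · simpa using h4.le

lemma ReachesDown.of_le_apply (h : ReachesDown F K ω') (hω : IsPath F K ω) (hK : 0 ≤ K)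
    (hle : ω K ≤ ω' K) : ReachesDown F K ω := by
  obtain ⟨n, hn⟩ := h
  refine ⟨n, fun h => ?_⟩
  obtain ⟨T, hT, ψ, h1, h2, h3⟩ := hn h
  obtain ⟨T', hT', ψ', g1, g2, g3⟩ := hω.exists_extension_reaching hK h1 hT.1
    (by rw [h2 K le_rfl]; exact hle) h3
  exact ⟨T', ⟨hT'.1, hT'.2.trans hT.2⟩, ψ', g1, g2, g3⟩

lemma ReachesUp.of_apply_le (h : ReachesUp F K ω') (hω : IsPath F K ω) (hK : 0 ≤ K)
    (hle : ω' K ≤ ω K) : ReachesUp F K ω :=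
  reachesDown_reflect_neg.1 <| h.reflect.of_le_apply (isPath_reflect_neg.2 hω) hK
    (by simpa using hle)

lemma exists_chain {α : Type*} (P : ℕ → α → Prop) (R : ℕ → α → α → Prop) {a : α} (h0 : P 0 a)
    (step : ∀ n a, P n a → ∃ b, P (n + 1) b ∧ R n a b) :
    ∃ f : ℕ → α, f 0 = a ∧ (∀ n, P n (f n)) ∧ ∀ n, R n (f n) (f (n + 1)) := by
  choose! g hg using step
  let f : ℕ → α := fun n => Nat.rec a (fun n b => g n b) n
  have hP : ∀ n, P n (f n) := fun n => by
    induction n with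
    | zero => exact h0
    | succ n ih => exact (hg n _ ih).1
  exact ⟨f, rfl, hP, fun n => (hg n _ (hP n)).2⟩

/-- If no solution from `ω K` drops to `-∞` in bounded time, and solutions above `ω K` survive for
arbitrarily long times, then there is a global solution: going down whenever a longer living
solution is met gives a decreasing sequence of longer and longer solutions. -/
lemma rightSolvable_of_not_reachesDown {K : ℕ} (hω : IsPath F K ω) (hd : ¬ ReachesDown F K ω)
    (hγ : ∀ n : ℕ, K ≤ n → ∃ γ, IsPath F n γ ∧ ω K ≤ γ K) : F ∈ rightSolvable := by
  simp only [ReachesDown, not_exists, not_forall, not_and, not_le] at hd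
  have hK : (0 : ℝ) ≤ K := K.cast_nonneg
  obtain ⟨χ, -, hχ, hanti⟩ := exists_chain (a := ω)
    (fun j χ => IsPath F ((K + j : ℕ) : ℝ) χ ∧ ∀ s ≤ (K : ℝ), χ s = ω s)
    (fun j χ χ' => ∀ s ∈ Icc 0 ((K + j : ℕ) : ℝ), χ' s ≤ χ s) (by simpa using hω) (by
      rintro j χ ⟨hχ, hχω⟩
      obtain ⟨γ, hγ, hle⟩ := hγ (K + (j + 1)) (by omega)
      have hKj : (K : ℝ) ≤ ((K + j : ℕ) : ℝ) := by exact_mod_cast Nat.le_add_right K j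
      have hj : ((K + j : ℕ) : ℝ) ≤ ((K + (j + 1) : ℕ) : ℝ) := by push_cast; linarith
      have h0 : (0 : ℝ) ≤ ((K + j : ℕ) : ℝ) := hK.trans hKj
      rcases le_total (χ ((K + j : ℕ) : ℝ)) (γ ((K + j : ℕ) : ℝ)) with hcase | hcase
      · obtain ⟨h, hh⟩ := hd ((K + (j + 1) : ℕ) : ℝ)
        obtain ⟨C, hC0, hC⟩ := exists_path_bound γ ((K + (j + 1) : ℕ) : ℝ)
        set M := max (-h) (max C (-χ ((K + j : ℕ) : ℝ))) with hM
        have hM1 : -h ≤ M := le_max_left _ _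
        have hM2 : C ≤ M := (le_max_left _ _).trans (le_max_right _ _)
        have hM3 : -χ ((K + j : ℕ) : ℝ) ≤ M := (le_max_right _ _).trans (le_max_right _ _)
        obtain ⟨T', hT', χ', g1, g2, g3, g4⟩ := hχ.exists_extension_le (M := M) hγ h0 hj hcase
          (fun s hs => by
            have := (abs_lt.1 (hC s ⟨h0.trans hs.1, hs.2⟩)).1
            linarith) (by linarith)
        have hχ'ω : ∀ s ≤ (K : ℝ), χ' s = ω s := fun s hs => by
          rw [g2 s (hs.trans hKj), hχω s hs]
        rcases g4 with rfl | g4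
        · exact ⟨χ', ⟨g1, hχ'ω⟩, fun s hs => (g2 s hs.2).le⟩
        · exfalso
          have := hh T' ⟨hKj.trans hT'.1, hT'.2⟩ χ' g1 hχ'ω
          linarith
      · obtain ⟨c, hc, hc1, hc2⟩ := exists_last_crossing χ.continuous γ.continuous hKj
          (by rw [hχω _ le_rfl]; exact hle) hcase
        obtain ⟨χ', g1, g2, g3⟩ := (hχ.mono hc.2).glue hγ (hK.trans hc.1) (hc.2.trans hj) hc1
        refine ⟨χ', ⟨g1, fun s hs => by rw [g2 s (hs.trans hc.1), hχω s hs]⟩, fun s hs => ?_⟩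
        rcases le_total s c with hsc | hsc
        · exact (g2 s hsc).le
        · rw [g3 s ⟨hsc, hs.2.trans hj⟩]
          exact hc2 s ⟨hsc, hs.2⟩)
  refine rightSolvable_of_antitone (T := fun j => ((K + j : ℕ) : ℝ)) ?_ ?_ (fun n => (hχ n).1)
    hanti fun n => ?_
  · exact fun a b hab => Nat.cast_le.2 (Nat.add_le_add_left hab K)
  · exact tendsto_natCast_atTop_atTop.comp
      (tendsto_atTop_mono (fun j => Nat.le_add_left j K) tendsto_id)
  · obtain ⟨h, hh⟩ := hd ((K + n : ℕ) : ℝ)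
    obtain ⟨C, hC0, hC⟩ := exists_path_bound ω K
    refine ⟨min h (-C), fun N hN s hs => ?_⟩
    rcases le_total s K with hsK | hsK
    · rw [(hχ N).2 s hsK]
      have := (abs_lt.1 (hC s ⟨hs.1, hsK⟩)).1
      linarith [min_le_right h (-C)]
    · have hle : s ≤ ((K + N : ℕ) : ℝ) :=
        hs.2.trans (by exact_mod_cast Nat.add_le_add_left hN K)
      have := hh s ⟨hsK, hs.2⟩ (χ N) ((hχ N).1.mono hle) (hχ N).2
      linarith [min_le_left h (-C)]

/-- The mirror image of `rightSolvable_of_not_reachesDown`. -/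
lemma rightSolvable_of_not_reachesUp {K : ℕ} (hω : IsPath F K ω) (hd : ¬ ReachesUp F K ω)
    (hγ : ∀ n : ℕ, K ≤ n → ∃ γ, IsPath F n γ ∧ γ K ≤ ω K) : F ∈ rightSolvable := by
  rw [← reflect_mem_rightSolvable]
  refine rightSolvable_of_not_reachesDown (isPath_reflect_neg.2 hω)
    (fun h => hd (reachesDown_reflect_neg.1 h)) fun n hn => ?_
  obtain ⟨γ, h1, h2⟩ := hγ n hn
  exact ⟨-γ, isPath_reflect_neg.2 h1, by simpa using h2⟩

/-- If at every time some reachable position can be driven to both infinities, then these positions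
lie on a common global solution: the escaping solutions from one of them meet every solution
through a sufficiently late one. -/
lemma rightSolvable_of_reaches_both
    (h : ∀ K : ℕ, ∃ ω, IsPath F K ω ∧ ReachesUp F K ω ∧ ReachesDown F K ω) :
    F ∈ rightSolvable := by
  obtain ⟨ω₀, hω₀⟩ := h 0
  obtain ⟨f, -, hf, hR⟩ := exists_chain (a := ((0 : ℕ), ω₀))
    (fun _ p => IsPath F (p.1 : ℕ) p.2 ∧ ReachesUp F (p.1 : ℕ) p.2 ∧ ReachesDown F (p.1 : ℕ) p.2)
    (fun _ p q => p.1 < q.1 ∧ ∀ s ≤ ((p.1 : ℕ) : ℝ), q.2 s = p.2 s) hω₀ (by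
      rintro - ⟨K, ω⟩ ⟨hω, ⟨n₁, h₁⟩, ⟨n₂, h₂⟩⟩
      dsimp only at hω h₁ h₂ ⊢
      obtain ⟨K', hK'⟩ := exists_nat_ge (max (max n₁ n₂) (K + 1 : ℝ))
      have hn₁ : n₁ ≤ K' := ((le_max_left _ _).trans (le_max_left _ _)).trans hK'
      have hn₂ : n₂ ≤ K' := ((le_max_right _ _).trans (le_max_left _ _)).trans hK'
      have hKK' : K < K' := by exact_mod_cast (le_max_right _ _).trans hK'
      have hK : (0 : ℝ) ≤ K := K.cast_nonneg
      have hK0 : (0 : ℝ) ≤ K' := K'.cast_nonneg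
      obtain ⟨ω', hω', hup, hdown⟩ := h K'
      obtain ⟨C, hC0, hC⟩ := exists_path_bound ω' K'
      suffices hmeet : ∃ c ∈ Icc (K : ℝ) K', ∃ ψ, IsPath F c ψ ∧ (∀ s ≤ (K : ℝ), ψ s = ω s) ∧
          ψ c = ω' c by
        obtain ⟨c, hc, ψ, h3, h4, h5⟩ := hmeet
        obtain ⟨ψ', g1, g2, g3⟩ := h3.glue hω' (hK.trans hc.1) hc.2 h5
        have h6 := g3 (K' : ℝ) ⟨hc.2, le_rfl⟩
        exact ⟨(K', ψ'), ⟨g1, hup.of_apply_le g1 hK0 h6.ge, hdown.of_le_apply g1 hK0 h6.le⟩, hKK',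
          fun s hs => by rw [g2 s (hs.trans hc.1), h4 s hs]⟩
      rcases le_total (ω K) (ω' K) with hcase | hcase
      · obtain ⟨T, hT, ψ, h3, h4, h5⟩ := h₁ C
        have hTK : T ≤ K' := hT.2.trans hn₁
        obtain ⟨c, hc, hc1, -⟩ := exists_first_crossing ψ.continuous ω'.continuous hT.1
          (by rw [h4 K le_rfl]; exact hcase)
          (((le_abs_self _).trans (hC T ⟨hK.trans hT.1, hTK⟩).le).trans h5)
        exact ⟨c, ⟨hc.1, hc.2.trans hTK⟩, ψ, h3.mono hc.2, h4, hc1⟩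
      · obtain ⟨T, hT, ψ, h3, h4, h5⟩ := h₂ (-C)
        have hTK : T ≤ K' := hT.2.trans hn₂
        obtain ⟨c, hc, hc1, -⟩ := exists_first_crossing ω'.continuous ψ.continuous hT.1
          (by rw [h4 K le_rfl]; exact hcase)
          (h5.trans (abs_lt.1 (hC T ⟨hK.trans hT.1, hTK⟩)).1.le)
        exact ⟨c, ⟨hc.1, hc.2.trans hTK⟩, ψ, h3.mono hc.2, h4, hc1.symm⟩)
  have hmono : StrictMono fun n => (f n).1 := strictMono_nat_of_lt_succ fun n => (hR n).1
  exact rightSolvable_of_extensions (T := fun n => ((f n).1 : ℝ)) (χ := fun n => (f n).2)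
    (fun a b hab => Nat.cast_le.2 (hmono.monotone hab))
    (tendsto_natCast_atTop_atTop.comp hmono.tendsto_atTop) (fun n => (hf n).1) fun n => (hR n).2

/-- A solution that ends between two others can be replaced by one within their bounds. -/
lemma IsPath.exists_squeezed {a b : C(ℝ, ℝ)} (hω : IsPath F K ω) (ha : IsPath F K a)
    (hb : IsPath F K b) (hK : 0 ≤ K) (haω : a K ≤ ω K) (hωb : ω K ≤ b K) {C : ℝ}
    (haC : ∀ s ∈ Icc 0 K, |a s| ≤ C) (hbC : ∀ s ∈ Icc 0 K, |b s| ≤ C) :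
    ∃ ψ, IsPath F K ψ ∧ ψ K = ω K ∧ ∀ s ∈ Icc 0 K, ψ s ∈ Icc (-C) C := by
  obtain ⟨c, hc, hc1, hc2⟩ := exists_last_crossing b.continuous ω.continuous hK
    (by rw [hb.map_zero hK, hω.map_zero hK]) hωb
  obtain ⟨ψ, h1, h2, h3⟩ := (hb.mono hc.2).glue hω hc.1 hc.2 hc1
  have hψK : ψ K = ω K := h3 K ⟨hc.2, le_rfl⟩
  have hψC : ∀ s ∈ Icc 0 K, ψ s ≤ C := by
    intro s hs
    have hbs := (le_abs_self _).trans (hbC s hs)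
    rcases le_total s c with hsc | hsc
    · rwa [h2 s hsc]
    · rw [h3 s ⟨hsc, hs.2⟩]; exact (hc2 s ⟨hsc, hs.2⟩).trans hbs
  obtain ⟨d, hd, hd1, hd2⟩ := exists_last_crossing ψ.continuous a.continuous hK
    (by rw [h1.map_zero hK, ha.map_zero hK]) (by rw [hψK]; exact haω)
  obtain ⟨ψ', g1, g2, g3⟩ := (ha.mono hd.2).glue h1 hd.1 hd.2 hd1.symm
  refine ⟨ψ', g1, by rw [g3 K ⟨hd.2, le_rfl⟩, hψK], fun s hs => ?_⟩
  have has := abs_le.1 (haC s hs)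
  rcases le_total s d with hsd | hsd
  · rw [g2 s hsd]; exact has
  · rw [g3 s ⟨hsd, hs.2⟩]
    exact ⟨has.1.trans (hd2 s ⟨hsd, hs.2⟩), hψC s hs⟩

/-- Suppose that at every time some reachable position can be driven to `-∞` and some to `+∞`.
If at some time no position can be driven to both, then the positions are separated into a lower
and an upper part, and the solutions from the boundary position survive. -/
lemma rightSolvable_of_reaches
    (hdown : ∀ K : ℕ, ∃ ω, IsPath F K ω ∧ ReachesDown F K ω)
    (hup : ∀ K : ℕ, ∃ ω, IsPath F K ω ∧ ReachesUp F K ω) : F ∈ rightSolvable := by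
  by_cases hboth : ∀ K : ℕ, ∃ ω, IsPath F K ω ∧ ReachesUp F K ω ∧ ReachesDown F K ω
  · exact rightSolvable_of_reaches_both hboth
  push Not at hboth
  obtain ⟨K, hK⟩ := hboth
  have hK0 : (0 : ℝ) ≤ K := K.cast_nonneg
  obtain ⟨a, ha, had⟩ := hdown K
  obtain ⟨b, hb, hbu⟩ := hup K
  have hsep : ∀ ω ω', IsPath F K ω → IsPath F K ω' → ReachesDown F K ω → ReachesUp F K ω' →
      ω K < ω' K := by
    intro ω ω' h1 h2 h3 h4
    by_contra hlt
    exact hK ω h1 (h4.of_apply_le h1 hK0 (not_lt.1 hlt)) h3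
  obtain ⟨A, hA0, hA⟩ := exists_path_bound a K
  obtain ⟨B, hB0, hB⟩ := exists_path_bound b K
  set C := max A B
  let S : Set ℝ := {z | ∃ ω, IsPath F K ω ∧ ReachesDown F K ω ∧ a K ≤ ω K ∧ ω K = z}
  have hSne : S.Nonempty := ⟨_, a, ha, had, le_rfl, rfl⟩
  have hSbdd : BddAbove S := ⟨b K, by
    rintro _ ⟨ω, h1, h2, -, rfl⟩
    exact (hsep ω b h1 hb h2 hbu).le⟩
  let V : Set ℝ := {z | (F, z) ∈ boundedPathSet K K K univ (Icc (-C) C) {p | p.1 = p.2}}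
  have hV : IsClosed V := (isClosed_boundedPathSet hK0 le_rfl isClosed_univ
    (isClosed_eq continuous_fst continuous_snd)).preimage (continuous_const.prodMk continuous_id)
  have hSV : S ⊆ V := by
    rintro _ ⟨ω, h1, h2, h3, rfl⟩
    obtain ⟨ψ, g1, g2, g3⟩ := h1.exists_squeezed ha hb hK0 h3 (hsep ω b h1 hb h2 hbu).le
      (C := C) (fun s hs => (hA s hs).le.trans (le_max_left _ _))
      (fun s hs => (hB s hs).le.trans (le_max_right _ _))
    exact ⟨K, ⟨le_rfl, le_rfl⟩, ψ, g1, fun _ _ => mem_univ _, g3, g2⟩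
  obtain ⟨T, hT, ω, hω, -, -, hωw⟩ := closure_minimal hSV hV (csSup_mem_closure hSne hSbdd)
  obtain rfl : T = K := le_antisymm hT.2 hT.1
  replace hωw : ω K = sSup S := hωw
  have hmax : ∀ ω', IsPath F K ω' → ReachesDown F K ω' → ω' K ≤ ω K := by
    intro ω' h1 h2
    rw [hωw]
    rcases le_total (a K) (ω' K) with h | h
    · exact le_csSup hSbdd ⟨ω', h1, h2, h, rfl⟩
    · exact h.trans (le_csSup hSbdd ⟨a, ha, had, le_rfl, rfl⟩)
  by_cases hωd : ReachesDown F K ω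
  · refine rightSolvable_of_not_reachesUp hω (fun h => hK ω hω h hωd) fun n hn => ?_
    obtain ⟨γ, h1, h2⟩ := hdown n
    have hn' : (K : ℝ) ≤ n := Nat.cast_le.2 hn
    exact ⟨γ, h1, hmax γ (h1.mono hn') (h2.of_le hn')⟩
  · refine rightSolvable_of_not_reachesDown hω hωd fun n hn => ?_
    obtain ⟨γ, h1, h2⟩ := hup n
    have hn' : (K : ℝ) ≤ n := Nat.cast_le.2 hn
    refine ⟨γ, h1, ?_⟩
    by_contra hlt
    rw [not_le, hωw] at hlt
    obtain ⟨_, ⟨ω', g1, g2, -, rfl⟩, g4⟩ := exists_lt_of_lt_csSup hSne hlt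
    exact absurd (hsep ω' γ g1 (h1.mono hn') g2 (h2.of_le hn')) (not_lt.2 g4.le)

end Reaches

/-! ### The Borel complexity of solvability to the right -/

/-- For every `n`, some solution exists up to time `n` within some level `M > k`, while no solution
falls to the level `-M` by the time `n` within these bounds. All solutions considered have values
in `[-k, k]` during `[0, K]`. -/
def stayingAbove (K k : ℕ) : Set C(ℝ × ℝ, ℝ) :=
  {F | ∀ n : ℕ, K ≤ n → ∃ m : ℕ,
    (F, (0 : ℝ)) ∈ boundedPathSet K n n (Icc (-k) k) (Icc (-(k + 1 + m)) (k + 1 + m)) univ ∧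
    (F, -(k + 1 + m : ℝ)) ∉
      boundedPathSet K K n (Icc (-k) k) (Icc (-(k + 1 + m)) (k + 1 + m)) {p | p.1 = p.2}}

/-- For some `k` and `n`, every low level is reached by the time `n` by solutions that have values
in `[-k, k]` during `[0, K]` and stay below `k`. These bounds make the condition on each level a
closed one. -/
def fallingAfter (K : ℕ) : Set C(ℝ × ℝ, ℝ) :=
  {F | ∃ k n : ℕ, K ≤ n ∧ ∀ h : ℕ, k ≤ h →
    (F, -(h : ℝ)) ∈ boundedPathSet K K n (Icc (-k) k) (Icc (-h) k) {p | p.1 = p.2}}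

section Complexity

variable {F : C(ℝ × ℝ, ℝ)}

/-- Among the solutions within given bounds one has the least final value, by compactness. -/
lemma IsPath.exists_lowest {K k : ℝ} {φ : C(ℝ, ℝ)} (hK : 0 ≤ K) (hφ : IsPath F K φ)
    (hφk : ∀ s ∈ Icc 0 K, φ s ∈ Icc (-k) k) :
    ∃ ω, IsPath F K ω ∧ (∀ s ∈ Icc 0 K, ω s ∈ Icc (-k) k) ∧
      ∀ ψ, IsPath F K ψ → (∀ s ∈ Icc 0 K, ψ s ∈ Icc (-k) k) → ω K ≤ ψ K := by
  let V : Set ℝ := {z | (F, z) ∈ boundedPathSet K K K univ (Icc (-k) k) {p | p.1 = p.2}}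
  have hV : IsClosed V := (isClosed_boundedPathSet hK le_rfl isClosed_univ
    (isClosed_eq continuous_fst continuous_snd)).preimage (continuous_const.prodMk continuous_id)
  have hmem : ∀ ψ, IsPath F K ψ → (∀ s ∈ Icc 0 K, ψ s ∈ Icc (-k) k) → ψ K ∈ V := fun ψ h1 h2 =>
    ⟨K, ⟨le_rfl, le_rfl⟩, ψ, h1, fun _ _ => mem_univ _, h2, rfl⟩
  have hsub : V ⊆ Icc (-k) k := by
    rintro z ⟨T, hT, ψ, -, -, h2, h3⟩
    obtain rfl : T = K := le_antisymm hT.2 hT.1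
    replace h3 : ψ T = z := h3
    rw [← h3]
    exact h2 T ⟨hK, le_rfl⟩
  obtain ⟨z, ⟨T, hT, ω, h1, -, h2, h3⟩, hz⟩ :=
    (isCompact_Icc.of_isClosed_subset hV hsub).exists_isLeast ⟨_, hmem φ hφ hφk⟩
  obtain rfl : T = K := le_antisymm hT.2 hT.1
  replace h3 : ω T = z := h3
  exact ⟨ω, h1, h2, fun ψ g1 g2 => h3.le.trans (hz (hmem ψ g1 g2))⟩

/-- The lowest position at time `K` cannot be driven to `-∞`: a solution from there to `-M` would
cross the solution bounded by `M`, and gluing them gives a solution within the bounds that falls to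
`-M`. -/
lemma rightSolvable_of_mem_stayingAbove {K k : ℕ} (h : F ∈ stayingAbove K k) :
    F ∈ rightSolvable := by
  have hK : (0 : ℝ) ≤ K := K.cast_nonneg
  have hpath : ∀ n : ℕ, K ≤ n → ∃ φ, IsPath F n φ ∧ ∀ s ∈ Icc (0 : ℝ) K, φ s ∈ Icc (-k : ℝ) k := by
    intro n hn
    obtain ⟨m, ⟨T, hT, φ, h1, h2, -, -⟩, -⟩ := h n hn
    obtain rfl : T = n := le_antisymm hT.2 hT.1
    exact ⟨φ, h1, h2⟩
  obtain ⟨φ₀, hφ₀, hφ₀k⟩ := hpath K le_rfl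
  obtain ⟨ω, hω, hωk, hmin⟩ := hφ₀.exists_lowest hK hφ₀k
  refine rightSolvable_of_not_reachesDown hω ?_ fun n hn => ?_
  · rintro ⟨n₀, hn₀⟩
    obtain ⟨n, hn⟩ := exists_nat_ge (max n₀ K)
    have hKn : K ≤ n := by exact_mod_cast (le_max_right _ _).trans hn
    obtain ⟨m, ⟨T, hT, φ, h1, h2, h3, -⟩, hnot⟩ := h n hKn
    obtain rfl : T = n := le_antisymm hT.2 hT.1
    set M : ℝ := k + 1 + m
    have hkM : (k : ℝ) ≤ M := by
      have : (0 : ℝ) ≤ m := m.cast_nonneg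
      simp only [M]; linarith
    obtain ⟨T, hT, ψ, g1, g2, g3⟩ := hn₀ (-M)
    have hTn : T ≤ n := hT.2.trans ((le_max_left _ _).trans hn)
    have hKn' : (K : ℝ) ≤ n := Nat.cast_le.2 hKn
    have hωK := hωk K ⟨hK, le_rfl⟩
    obtain ⟨c, hc, hc1, hc2⟩ := exists_first_crossing (f := fun _ => -M) continuous_const
      ψ.continuous hT.1 (by rw [g2 K le_rfl]; linarith [hωK.1]) g3
    have hc0 : 0 ≤ c := hK.trans hc.1
    have hcn : c ≤ n := hc.2.trans hTn
    obtain ⟨d, hd, hd1, hd2⟩ := exists_last_crossing φ.continuous ψ.continuous hc0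
      (by rw [h1.map_zero (hK.trans hKn'), g1.map_zero (hK.trans hT.1)])
      (by rw [← hc1]; exact (h3 c ⟨hc0, hcn⟩).1)
    obtain ⟨ψ', e1, e2, e3⟩ := (h1.mono (hd.2.trans hcn)).glue (g1.mono hc.2) hd.1 hd.2 hd1
    have hψ : ∀ s ∈ Icc 0 c, -M ≤ ψ s := fun s hs => by
      rcases le_total s K with hsK | hsK
      · rw [g2 s hsK]; linarith [(hωk s ⟨hs.1, hsK⟩).1]
      · exact hc2 s ⟨hsK, hs.2⟩
    refine hnot ⟨c, ⟨hc.1, hcn⟩, ψ', e1, fun s hs => ?_, fun s hs => ?_, ?_⟩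
    · rcases le_total s d with hsd | hsd
      · rw [e2 s hsd]; exact h2 s hs
      · rw [e3 s ⟨hsd, hs.2.trans hc.1⟩, g2 s hs.2]; exact hωk s hs
    · have hφs := h3 s ⟨hs.1, hs.2.trans hcn⟩
      rcases le_total s d with hsd | hsd
      · rw [e2 s hsd]; exact hφs
      · rw [e3 s ⟨hsd, hs.2⟩]; exact ⟨hψ s hs, (hd2 s ⟨hsd, hs.2⟩).trans hφs.2⟩
    · change ψ' c = -M
      rw [e3 c ⟨hd.2, le_rfl⟩, ← hc1]
  · obtain ⟨φ, h1, h2⟩ := hpath n hn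
    exact ⟨φ, h1, hmin φ (h1.mono (Nat.cast_le.2 hn)) h2⟩

/-- The falling solutions are bounded above only by their own depth, but following the global
solution `γ` up to the last time they meet makes them bounded above by a fixed level. -/
lemma mem_fallingAfter {K k : ℕ} {γ : C(ℝ, ℝ)} (hγ : ∀ T, IsPath F T γ)
    (hk : ∀ s ∈ Icc (0 : ℝ) K, γ s ∈ Icc (-k : ℝ) k) (h : F ∉ stayingAbove K k) :
    F ∈ fallingAfter K := by
  have hK : (0 : ℝ) ≤ K := K.cast_nonneg
  simp only [stayingAbove, mem_ofPred_eq, not_forall, not_exists, not_and, not_not] at h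
  obtain ⟨n, hn, hm⟩ := h
  obtain ⟨C, hC0, hC⟩ := exists_path_bound γ n
  obtain ⟨m₀, hm₀⟩ := exists_nat_ge C
  refine ⟨k + 1 + m₀, n, hn, fun h hh => ?_⟩
  obtain ⟨j, rfl⟩ := Nat.exists_eq_add_of_le hh
  have hj : (0 : ℝ) ≤ j := j.cast_nonneg
  have hk0 : (0 : ℝ) ≤ k := k.cast_nonneg
  have hKn : (K : ℝ) ≤ n := Nat.cast_le.2 hn
  obtain ⟨T, hT, ψ, h1, h2, h3, h4⟩ := hm (m₀ + j) ⟨n, ⟨le_rfl, le_rfl⟩, γ, hγ n, hk, fun s hs => by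
    have := abs_lt.1 (hC s hs)
    push_cast
    constructor <;> linarith, mem_univ _⟩
  replace h4 : ψ T = -(k + 1 + (m₀ + j : ℕ) : ℝ) := h4
  push_cast at h3 h4 ⊢
  have hT0 : 0 ≤ T := hK.trans hT.1
  obtain ⟨d, hd, hd1, hd2⟩ := exists_last_crossing γ.continuous ψ.continuous hT0
    (by rw [(hγ T).map_zero hT0, h1.map_zero hT0])
    (by rw [h4]; have := abs_lt.1 (hC T ⟨hT0, hT.2⟩); linarith)
  obtain ⟨ψ', e1, e2, e3⟩ := (hγ d).glue h1 hd.1 hd.2 hd1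
  refine ⟨T, hT, ψ', e1, fun s hs => ?_, fun s hs => ?_, ?_⟩
  · rcases le_total s d with hsd | hsd
    · rw [e2 s hsd]
      have := hk s hs
      constructor <;> linarith [this.1, this.2, m₀.cast_nonneg (α := ℝ)]
    · rw [e3 s ⟨hsd, hs.2.trans hT.1⟩]
      have := h2 s hs
      constructor <;> linarith [this.1, this.2, m₀.cast_nonneg (α := ℝ)]
  · have hγs := abs_lt.1 (hC s ⟨hs.1, hs.2.trans hT.2⟩)
    rcases le_total s d with hsd | hsd
    · rw [e2 s hsd]
      constructor <;> linarith [hγs.1, hγs.2]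
    · rw [e3 s ⟨hsd, hs.2⟩]
      have := (h3 s hs).1
      have := hd2 s ⟨hsd, hs.2⟩
      constructor <;> linarith [hγs.1, hγs.2]
  · change ψ' T = _
    rw [e3 T ⟨hd.2, le_rfl⟩, h4]
    ring

/-- The falling solutions start at different positions at time `K`, and the lowest position serves
for all of them. -/
lemma exists_reachesDown {K : ℕ} (h : F ∈ fallingAfter K) :
    ∃ ω, IsPath F K ω ∧ ReachesDown F K ω := by
  have hK : (0 : ℝ) ≤ K := K.cast_nonneg
  obtain ⟨k, n, hn, h⟩ := h
  obtain ⟨T₀, hT₀, φ, h1, h2, -⟩ := h k le_rfl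
  obtain ⟨ω, hω, hωk, hmin⟩ := (h1.mono hT₀.1).exists_lowest hK h2
  refine ⟨ω, hω, n, fun h' => ?_⟩
  obtain ⟨j, hj⟩ := exists_nat_ge (-h')
  obtain ⟨T, hT, ψ, g1, g2, -, g3⟩ := h (k + j) (by omega)
  replace g3 : ψ T = -((k + j : ℕ) : ℝ) := g3
  obtain ⟨T', hT', ψ', e⟩ := hω.exists_extension_reaching hK g1 hT.1
    (hmin ψ (g1.mono hT.1) g2) (h := h') (by
      rw [g3]; push_cast; linarith [k.cast_nonneg (α := ℝ)])
  exact ⟨T', ⟨hT'.1, hT'.2.trans hT.2⟩, ψ', e⟩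

lemma mem_rightSolvable_iff : F ∈ rightSolvable ↔
    (∃ K k, F ∈ stayingAbove K k) ∨ (∃ K k, reflect F ∈ stayingAbove K k) ∨
      ∀ K, F ∈ fallingAfter K ∧ reflect F ∈ fallingAfter K := by
  constructor
  · rintro ⟨γ, hγ⟩
    refine or_iff_not_imp_left.2 fun h1 => or_iff_not_imp_left.2 fun h2 K => ?_
    push Not at h1 h2
    obtain ⟨C, hC0, hC⟩ := exists_path_bound γ K
    obtain ⟨k, hk⟩ := exists_nat_ge C
    refine ⟨mem_fallingAfter hγ (fun s hs => ?_) (h1 K k),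
      mem_fallingAfter (γ := -γ) (fun T => isPath_reflect_neg.2 (hγ T)) (fun s hs => ?_) (h2 K k)⟩
    · exact abs_le.1 ((hC s hs).le.trans hk)
    · refine abs_le.1 ?_
      simpa using (hC s hs).le.trans hk
  · rintro (⟨K, k, h⟩ | ⟨K, k, h⟩ | h)
    · exact rightSolvable_of_mem_stayingAbove h
    · exact reflect_mem_rightSolvable.1 (rightSolvable_of_mem_stayingAbove h)
    · refine rightSolvable_of_reaches (fun K => exists_reachesDown (h K).1) fun K => ?_
      obtain ⟨ω, h1, h2⟩ := exists_reachesDown (h K).2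
      exact ⟨-ω, isPath_reflect.1 h1, by simpa using h2.reflect⟩

lemma isPiThree_stayingAbove (K k : ℕ) : IsPiThree (stayingAbove K k) := by
  have h : stayingAbove K k = ⋂ n : ℕ, ⋂ _ : K ≤ n, ⋃ m : ℕ,
      ((fun F => (F, (0 : ℝ))) ⁻¹'
        boundedPathSet K n n (Icc (-k) k) (Icc (-(k + 1 + m)) (k + 1 + m)) univ) ∩
      ((fun F => (F, -(k + 1 + m : ℝ))) ⁻¹'
        boundedPathSet K K n (Icc (-k) k) (Icc (-(k + 1 + m)) (k + 1 + m)) {p | p.1 = p.2})ᶜ := by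
    ext F
    simp [stayingAbove]
  rw [h]
  refine .iInter fun n => .iInter fun hn => .of_isFSigma (.iUnion fun m => .inter ?_ ?_)
  · exact .of_isClosed ((isClosed_boundedPathSet K.cast_nonneg (Nat.cast_le.2 hn) isClosed_Icc
      isClosed_univ).preimage (by fun_prop))
  · exact .of_isOpen ((isClosed_boundedPathSet K.cast_nonneg le_rfl isClosed_Icc
      (isClosed_eq continuous_fst continuous_snd)).preimage (by fun_prop)).isOpen_compl

lemma isFSigma_fallingAfter (K : ℕ) : IsFSigma (fallingAfter K) := by
  have h : fallingAfter K = ⋃ k : ℕ, ⋃ n : ℕ, ⋃ _ : K ≤ n, ⋂ h : ℕ, ⋂ _ : k ≤ h,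
      (fun F => (F, -(h : ℝ))) ⁻¹'
        boundedPathSet K K n (Icc (-k) k) (Icc (-h) k) {p | p.1 = p.2} := by
    ext F
    simp [fallingAfter]
  rw [h]
  refine .iUnion fun k => .iUnion fun n => .iUnion fun hn => .of_isClosed <|
    isClosed_iInter fun h => isClosed_iInter fun _ => ?_
  exact (isClosed_boundedPathSet K.cast_nonneg le_rfl isClosed_Icc
    (isClosed_eq continuous_fst continuous_snd)).preimage (by fun_prop)

lemma isSigmaFour_rightSolvable : IsSigmaFour rightSolvable := by
  have h : rightSolvable = (⋃ K, ⋃ k, stayingAbove K k) ∪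
      ((⋃ K, ⋃ k, reflect ⁻¹' stayingAbove K k) ∪
      ⋂ K, (fallingAfter K ∩ reflect ⁻¹' fallingAfter K)) := by
    ext F
    simp [mem_rightSolvable_iff]
  rw [h]
  refine .union (.iUnion fun K => .iUnion fun k => .of_isPiThree (isPiThree_stayingAbove K k))
    (.union (.iUnion fun K => .iUnion fun k => .of_isPiThree
      ((isPiThree_stayingAbove K k).preimage continuous_reflect))
      (.of_isPiThree (.iInter fun K => .of_isFSigma ((isFSigma_fallingAfter K).inter
        ((isFSigma_fallingAfter K).preimage continuous_reflect)))))

end Complexity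

/-! ### Splitting a Cauchy problem into its two sides -/

/-- The field of the equation solved on `[0, ∞)` by `s ↦ φ (x + ε s) - y` if `φ` solves the Cauchy
problem `(F, x, y)`. The signs `ε = 1` and `ε = -1` describe the two sides of the initial time. -/
def sideField (ε : ℝ) (P : CauchyProblem) : C(ℝ × ℝ, ℝ) :=
  ⟨fun p => ε * P.1 (P.2.1 + ε * p.1, P.2.2 + p.2), by fun_prop⟩

lemma continuous_sideField (ε : ℝ) : Continuous (sideField ε) := by
  refine ContinuousMap.continuous_of_continuous_uncurry _ ?_
  change Continuous fun q : CauchyProblem × (ℝ × ℝ) =>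
    ε * q.1.1 (q.1.2.1 + ε * q.2.1, q.1.2.2 + q.2.2)
  fun_prop

lemma sideField_mem_rightSolvable {P : CauchyProblem} {φ : ℝ → ℝ} (h : IsGlobalSolution P φ)
    (ε : ℝ) : sideField ε P ∈ rightSolvable := by
  have hφ : Continuous φ := continuous_iff_continuousAt.2 fun t => (h.2 t).continuousAt
  refine ⟨⟨fun s => φ (P.2.1 + ε * s) - P.2.2, by fun_prop⟩, fun T s hs => ?_⟩
  have hd : ∀ u ∈ uIcc 0 s, HasDerivAt (fun s => φ (P.2.1 + ε * s) - P.2.2)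
      (ε * P.1 (P.2.1 + ε * u, φ (P.2.1 + ε * u))) u := by
    intro u _
    have h1 : HasDerivAt (fun s => P.2.1 + ε * s) ε u := by
      simpa using ((hasDerivAt_id u).const_mul ε).const_add P.2.1
    have h2 := ((h.2 (P.2.1 + ε * u)).comp u h1).sub_const P.2.2
    rwa [mul_comm] at h2
  have hint := intervalIntegral.integral_eq_sub_of_hasDerivAt hd
    (Continuous.intervalIntegrable (by fun_prop) _ _)
  simp [sideField, -intervalIntegral.integral_const_mul, hint, h.1]

lemma exists_isGlobalSolution {P : CauchyProblem} (h₁ : sideField 1 P ∈ rightSolvable)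
    (h₂ : sideField (-1) P ∈ rightSolvable) : ∃ φ, IsGlobalSolution P φ := by
  obtain ⟨α, hα⟩ := h₁
  obtain ⟨β, hβ⟩ := h₂
  have hα0 : α 0 = 0 := (hα 0).map_zero le_rfl
  have hβ0 : β 0 = 0 := (hβ 0).map_zero le_rfl
  obtain ⟨F, x, y⟩ := P
  let φ : ℝ → ℝ := fun t => y + α (max (t - x) 0) + β (max (x - t) 0)
  have hφ : Continuous φ := by fun_prop
  have hφ1 : ∀ s, 0 ≤ s → φ (x + s) = y + α s := fun s hs => by
    simp [φ, hs, hβ0]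
  have hφ2 : ∀ s, 0 ≤ s → φ (x - s) = y + β s := fun s hs => by
    simp [φ, hs, hα0]
  have hint : ∀ t, φ t = y + ∫ u in x..t, F (u, φ u) := by
    intro t
    rcases le_total x t with hxt | hxt
    · obtain ⟨s, rfl⟩ : ∃ s, t = x + s := ⟨t - x, by ring⟩
      have hs : 0 ≤ s := by linarith
      have h1 := intervalIntegral.integral_comp_add_left (fun u => F (u, φ u)) (a := 0) (b := s) x
      rw [add_zero] at h1
      rw [hφ1 s hs, hα s s ⟨hs, le_rfl⟩, ← h1]
      congr 1
      refine intervalIntegral.integral_congr fun u hu => ?_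
      rw [uIcc_of_le hs] at hu
      simp [sideField, hφ1 u hu.1]
    · obtain ⟨s, rfl⟩ : ∃ s, t = x - s := ⟨x - t, by ring⟩
      have hs : 0 ≤ s := by linarith
      have h1 := intervalIntegral.integral_comp_sub_left (fun u => F (u, φ u)) (a := 0) (b := s) x
      rw [sub_zero] at h1
      rw [hφ2 s hs, hβ s s ⟨hs, le_rfl⟩, intervalIntegral.integral_symm (x - s) x, ← h1,
        ← intervalIntegral.integral_neg]
      congr 1
      refine intervalIntegral.integral_congr fun u hu => ?_
      rw [uIcc_of_le hs] at hu
      simp [sideField, hφ2 u hu.1, ← sub_eq_add_neg]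
  have hc : Continuous fun u => F (u, φ u) := by fun_prop
  refine ⟨φ, by simp [φ, hα0, hβ0], fun t => ?_⟩
  have h1 := (intervalIntegral.integral_hasDerivAt_right (hc.intervalIntegrable x t)
    (hc.stronglyMeasurableAtFilter _ _) hc.continuousAt).const_add y
  exact h1.congr_of_eventuallyEq (Eventually.of_forall hint)

lemma isSigmaFour_globallySolvable : IsSigmaFour globallySolvable := by
  have h : globallySolvable =
      sideField 1 ⁻¹' rightSolvable ∩ sideField (-1) ⁻¹' rightSolvable := by
    ext P
    exact ⟨fun ⟨φ, hφ⟩ => ⟨sideField_mem_rightSolvable hφ 1, sideField_mem_rightSolvable hφ (-1)⟩,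
      fun h => exists_isGlobalSolution h.1 h.2⟩
  rw [h]
  exact (isSigmaFour_rightSolvable.preimage (continuous_sideField 1)).inter
    (isSigmaFour_rightSolvable.preimage (continuous_sideField (-1)))

/-! ### A field with gates -/

/-- The left endpoint of the `i`-th window of the stage `[N + 1, N + 2]`. -/
noncomputable def windowStart (N i : ℕ) : ℝ := N + 2 - (1 / 2) ^ i

/-- A tent function supported on the `i`-th window of the stage `[N + 1, N + 2]`. -/
noncomputable def pulse (N i : ℕ) (t : ℝ) : ℝ :=
  16 * 4 ^ (i + 1) * max 0 (min (t - windowStart N i) (windowStart N (i + 1) - t))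

/-- A field, acting during the `i`-th window of the stage `[N + 1, N + 2]`, that transports all
points strictly between `a = i - N` and `a + 1` up to `a + 1`. The point `a + 1` is stationary, and
the point `a` is stationary if and only if `σ = 0`. -/
noncomputable def gate (N i : ℕ) (σ : ℝ) (p : ℝ × ℝ) : ℝ :=
  pulse N i p.1 * (√(1 - (2 * (p.2 - (i - N)) - 1) ^ 2) + σ * max 0 (1 - |p.2 - (i - N)|))

/-- A field acting during `[0, 1]` whose solutions from `(0, 0)` reach every point of `(-∞, 0]` at
time `1`. -/
noncomputable def funnel (p : ℝ × ℝ) : ℝ :=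
  -(24 * max 0 (p.1 * (1 - p.1)) * √(-p.2) * (1 + √(-p.2)) ^ 2)

/-- The superposition of the funnel and all gates, as a function of the gate parameters and the
point. -/
noncomputable def gateFieldFun (q : (ℕ → ℕ → ℝ) × (ℝ × ℝ)) : ℝ :=
  funnel q.2 + ∑ᶠ j : ℕ × ℕ, gate j.1 j.2 (q.1 j.1 j.2) q.2

section Gates

lemma windowStart_zero (N : ℕ) : windowStart N 0 = N + 1 := by
  simp only [windowStart, pow_zero]; ring

lemma windowStart_succ (N i : ℕ) :
    windowStart N (i + 1) = windowStart N i + (1 / 2) ^ (i + 1) := by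
  simp only [windowStart, pow_succ]; ring

lemma windowStart_lt_succ (N i : ℕ) : windowStart N i < windowStart N (i + 1) := by
  rw [windowStart_succ]
  have : (0 : ℝ) < (1 / 2) ^ (i + 1) := by positivity
  linarith

lemma strictMono_windowStart (N : ℕ) : StrictMono (windowStart N) :=
  strictMono_nat_of_lt_succ (windowStart_lt_succ N)

lemma le_windowStart (N i : ℕ) : (N : ℝ) + 1 ≤ windowStart N i :=
  (windowStart_zero N).symm.le.trans ((strictMono_windowStart N).monotone (Nat.zero_le i))

lemma windowStart_lt (N i : ℕ) : windowStart N i < N + 2 := by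
  have : (0 : ℝ) < (1 / 2) ^ i := by positivity
  simp only [windowStart]; linarith

lemma one_le_windowStart (N i : ℕ) : 1 ≤ windowStart N i :=
  le_trans (by simp) (le_windowStart N i)

lemma continuous_pulse (N i : ℕ) : Continuous (pulse N i) := by
  unfold pulse; fun_prop

lemma pulse_nonneg (N i : ℕ) (t : ℝ) : 0 ≤ pulse N i t := by
  unfold pulse; positivity

lemma pulse_of_le {N i : ℕ} {t : ℝ} (h : t ≤ windowStart N i) : pulse N i t = 0 := by
  rw [pulse, max_eq_left ((min_le_left _ _).trans (by linarith)), mul_zero]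

lemma pulse_of_ge {N i : ℕ} {t : ℝ} (h : windowStart N (i + 1) ≤ t) : pulse N i t = 0 := by
  rw [pulse, max_eq_left ((min_le_right _ _).trans (by linarith)), mul_zero]

lemma pulse_pos {N i : ℕ} {t : ℝ} (h : t ∈ Ioo (windowStart N i) (windowStart N (i + 1))) :
    0 < pulse N i t := by
  have h1 : 0 < min (t - windowStart N i) (windowStart N (i + 1) - t) :=
    lt_min (by linarith [h.1]) (by linarith [h.2])
  rw [pulse, max_eq_right h1.le]
  positivity

/-- On the middle half of its window the pulse is at least four divided by the length of the
window. -/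
lemma le_pulse {N i : ℕ} {t : ℝ} (h1 : windowStart N i + (1 / 2) ^ (i + 1) / 4 ≤ t)
    (h2 : t ≤ windowStart N i + 3 * (1 / 2) ^ (i + 1) / 4) : 4 * 2 ^ (i + 1) ≤ pulse N i t := by
  have h3 : (1 / 2 : ℝ) ^ (i + 1) / 4 ≤ min (t - windowStart N i) (windowStart N (i + 1) - t) :=
    le_min (by linarith) (by rw [windowStart_succ]; linarith)
  have h4 : (0 : ℝ) < 2 ^ (i + 1) := by positivity
  calc (4 : ℝ) * 2 ^ (i + 1) = 16 * 4 ^ (i + 1) * ((1 / 2) ^ (i + 1) / 4) := by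
        rw [show (4 : ℝ) ^ (i + 1) = 2 ^ (i + 1) * 2 ^ (i + 1) by rw [← mul_pow]; norm_num,
          one_div, inv_pow]
        field_simp
        norm_num
    _ ≤ pulse N i t := mul_le_mul_of_nonneg_left (h3.trans (le_max_right _ _)) (by positivity)

/-- The windows do not overlap. -/
lemma pulse_eq_zero {N i N' i' : ℕ} {t : ℝ}
    (h : t ∈ Icc (windowStart N i) (windowStart N (i + 1))) (hne : (N', i') ≠ (N, i)) :
    pulse N' i' t = 0 := by
  rcases lt_trichotomy N' N with hN | rfl | hN
  · refine pulse_of_ge ((windowStart_lt _ _).le.trans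
      (le_trans ?_ ((le_windowStart N i).trans h.1)))
    have : (N' : ℝ) + 1 ≤ N := by exact_mod_cast hN
    linarith
  · rcases lt_trichotomy i' i with hi | rfl | hi
    · exact pulse_of_ge (((strictMono_windowStart N').monotone hi).trans h.1)
    · exact absurd rfl hne
    · exact pulse_of_le (h.2.trans ((strictMono_windowStart N').monotone hi))
  · refine pulse_of_le ((h.2.trans (windowStart_lt _ _).le).trans
      (le_trans ?_ (le_windowStart N' i')))
    have : (N : ℝ) + 1 ≤ N' := by exact_mod_cast hN
    linarith

lemma gate_nonneg {N i : ℕ} {σ : ℝ} (hσ : 0 ≤ σ) (p : ℝ × ℝ) : 0 ≤ gate N i σ p := by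
  have := pulse_nonneg N i p.1
  unfold gate; positivity

/-- Integers are stationary for a gate, except that the lower end of a gate with positive parameter
is not. -/
lemma gate_intCast {N i : ℕ} {σ : ℝ} {t : ℝ} {q : ℤ} (h : (i : ℤ) - N = q → σ = 0) :
    gate N i σ (t, (q : ℝ)) = 0 := by
  obtain ⟨d, rfl⟩ : ∃ d, q = (i : ℤ) - N + d := ⟨q - ((i : ℤ) - N), by ring⟩
  have e : (((i : ℤ) - N + d : ℤ) : ℝ) - (i - N) = d := by push_cast; ring
  have h1 : √(1 - (2 * (d : ℝ) - 1) ^ 2) = 0 := by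
    refine Real.sqrt_eq_zero_of_nonpos ?_
    have : (0 : ℤ) ≤ d * (d - 1) := by
      rcases le_or_gt d 0 with hd | hd
      · exact mul_nonneg_of_nonpos_of_nonpos hd (by omega)
      · exact mul_nonneg hd.le (by omega)
    have : (0 : ℝ) ≤ d * (d - 1) := by exact_mod_cast this
    nlinarith
  have h2 : σ * max 0 (1 - |(d : ℝ)|) = 0 := by
    rcases eq_or_ne d 0 with rfl | hd
    · rw [h (by ring), zero_mul]
    · have : (1 : ℝ) ≤ |(d : ℝ)| := by exact_mod_cast Int.one_le_abs hd
      rw [max_eq_left (by linarith), mul_zero]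
  simp only [gate, e, h1, h2, add_zero, mul_zero]

lemma funnel_of_one_le {p : ℝ × ℝ} (h : 1 ≤ p.1) : funnel p = 0 := by
  rw [funnel, max_eq_left (by nlinarith)]; simp

lemma funnel_zero (t : ℝ) : funnel (t, 0) = 0 := by simp [funnel]

lemma finite_gates (T Z : ℕ) : {j : ℕ × ℕ | ∃ σ, ∃ p : ℝ × ℝ, p.1 < T ∧ p.2 < Z ∧
    gate j.1 j.2 σ p ≠ 0}.Finite := by
  refine ((finite_Iio T).prod (finite_Iio (Z + T + 1))).subset ?_
  rintro ⟨N, i⟩ ⟨σ, ⟨t, z⟩, ht, hz, hg⟩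
  dsimp only at ht hz hg
  have h1 : (N : ℝ) + 1 < t := by
    by_contra hle
    refine hg ?_
    simp only [gate]
    rw [pulse_of_le ((not_lt.1 hle).trans (le_windowStart N i)), zero_mul]
  have hN : N < T := by
    have : (N : ℝ) < T := by linarith
    exact_mod_cast this
  have h2 : (i : ℝ) - N - 1 < z := by
    by_contra hle
    rw [not_lt] at hle
    refine hg ?_
    have e1 : √(1 - (2 * (z - (i - N)) - 1) ^ 2) = 0 :=
      Real.sqrt_eq_zero_of_nonpos (by nlinarith)
    have e2 : max 0 (1 - |z - (i - N)|) = 0 :=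
      max_eq_left (by linarith [neg_abs_le (z - (i - N : ℝ))])
    simp only [gate, e1, e2, mul_zero, add_zero]
  refine ⟨hN, mem_Iio.2 ?_⟩
  have hN' : (N : ℝ) < T := by exact_mod_cast hN
  have : (i : ℝ) < ((Z + T + 1 : ℕ) : ℝ) := by push_cast; linarith
  exact_mod_cast this

lemma continuous_gateFieldFun : Continuous gateFieldFun := by
  refine Continuous.add (by unfold funnel; fun_prop) (continuous_finsum (fun j => ?_) ?_)
  · have := continuous_pulse j.1 j.2
    unfold gate; fun_prop
  · rintro ⟨s, t, z⟩
    obtain ⟨T, hT⟩ := exists_nat_gt t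
    obtain ⟨Z, hZ⟩ := exists_nat_gt z
    refine ⟨{q | q.2.1 < T ∧ q.2.2 < Z}, IsOpen.mem_nhds ?_ ⟨hT, hZ⟩,
      (finite_gates T Z).subset ?_⟩
    · exact (isOpen_lt continuous_snd.fst continuous_const).inter
        (isOpen_lt continuous_snd.snd continuous_const)
    · rintro j ⟨q, hq, hq'⟩
      exact ⟨_, q.2, hq'.1, hq'.2, hq⟩

/-- The field with gate parameters `s`, depending continuously on them. -/
noncomputable def gateField : C(ℕ → ℕ → ℝ, C(ℝ × ℝ, ℝ)) :=
  ContinuousMap.curry ⟨gateFieldFun, continuous_gateFieldFun⟩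

variable {s : ℕ → ℕ → ℝ} {N i : ℕ} {t : ℝ}

lemma gateField_apply (s : ℕ → ℕ → ℝ) (p : ℝ × ℝ) :
    gateField s p = funnel p + ∑ᶠ j : ℕ × ℕ, gate j.1 j.2 (s j.1 j.2) p := rfl

lemma gateField_of_le_one (ht : t ≤ 1) (z : ℝ) : gateField s (t, z) = funnel (t, z) := by
  have h : ∀ j : ℕ × ℕ, gate j.1 j.2 (s j.1 j.2) (t, z) = 0 := fun j => by
    simp only [gate]
    rw [pulse_of_le (ht.trans (one_le_windowStart _ _)), zero_mul]
  rw [gateField_apply, finsum_congr h, finsum_zero, add_zero]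

lemma gateField_nonneg (hs : ∀ N i, 0 ≤ s N i) (ht : 1 ≤ t) (z : ℝ) : 0 ≤ gateField s (t, z) := by
  rw [gateField_apply, funnel_of_one_le ht, zero_add]
  exact finsum_nonneg fun j => gate_nonneg (hs _ _) _

lemma gateField_of_mem_window (ht : t ∈ Icc (windowStart N i) (windowStart N (i + 1))) (z : ℝ) :
    gateField s (t, z) = gate N i (s N i) (t, z) := by
  rw [gateField_apply, funnel_of_one_le ((one_le_windowStart N i).trans ht.1), zero_add,
    finsum_eq_single _ (N, i)]
  intro j hj
  simp only [gate]
  rw [pulse_eq_zero ht hj, zero_mul]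

/-- During a stage, integers are stationary from the `i`-th window on, up to the first window with a
gate that lifts them. -/
lemma gateField_intCast {q : ℤ} (ht : t ∈ Icc (windowStart N i) (N + 2))
    (h : ∀ j, i ≤ j → (j : ℤ) - N = q → s N j = 0 ∨ t ≤ windowStart N j) :
    gateField s (t, (q : ℝ)) = 0 := by
  have h0 : ∀ j : ℕ × ℕ, gate j.1 j.2 (s j.1 j.2) (t, (q : ℝ)) = 0 := by
    rintro ⟨M, j⟩
    have hM : M ≠ N ∨ M = N ∧ j < i → pulse M j t = 0 := by
      rintro (hM | ⟨rfl, hj⟩)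
      · rcases hM.lt_or_gt with hM | hM
        · refine pulse_of_ge ((windowStart_lt _ _).le.trans
            (le_trans ?_ ((le_windowStart N i).trans ht.1)))
          have : (M : ℝ) + 1 ≤ N := by exact_mod_cast hM
          linarith
        · refine pulse_of_le (ht.2.trans (le_trans ?_ (le_windowStart M j)))
          have : (N : ℝ) + 1 ≤ M := by exact_mod_cast hM
          linarith
      · exact pulse_of_ge (((strictMono_windowStart M).monotone hj).trans ht.1)
    by_cases hc : M ≠ N ∨ M = N ∧ j < i
    · simp only [gate]; rw [hM hc, zero_mul]
    · push Not at hc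
      obtain ⟨rfl, hj⟩ := hc
      by_cases hq : (j : ℤ) - M = q
      · rcases h j (hj rfl) hq with h | h
        · exact gate_intCast fun _ => h
        · simp only [gate]; rw [pulse_of_le h, zero_mul]
      · exact gate_intCast fun h => absurd h hq
  rw [gateField_apply, funnel_of_one_le ((one_le_windowStart N i).trans ht.1), zero_add,
    finsum_congr h0, finsum_zero]

end Gates

/-! ### The dynamics of the gate field -/

section GateDynamics

variable {s : ℕ → ℕ → ℝ} {N i : ℕ} {T : ℝ} {ψ : C(ℝ, ℝ)}

lemma IsPath.hasDerivAt {F : C(ℝ × ℝ, ℝ)} (h : IsPath F T ψ) {t : ℝ} (ht : t ∈ Ioo 0 T) :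
    HasDerivAt ψ (F (t, ψ t)) t := by
  have hc := continuous_field_comp F ψ
  have h1 := intervalIntegral.integral_hasDerivAt_right (hc.intervalIntegrable 0 t)
    (hc.stronglyMeasurableAtFilter _ _) hc.continuousAt
  refine h1.congr_of_eventuallyEq ?_
  filter_upwards [Ioo_mem_nhds ht.1 ht.2] with u hu
  exact h u ⟨hu.1.le, hu.2.le⟩

lemma IsPath.monotoneOn (hs : ∀ N i, 0 ≤ s N i) (h : IsPath (gateField s) T ψ) :
    MonotoneOn ψ (Icc 1 T) := by
  have hd : ∀ t ∈ interior (Icc 1 T), HasDerivAt ψ (gateField s (t, ψ t)) t := fun t ht => by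
    rw [interior_Icc] at ht
    exact h.hasDerivAt ⟨one_pos.trans ht.1, ht.2⟩
  refine monotoneOn_of_deriv_nonneg (convex_Icc _ _) ψ.continuous.continuousOn
    (fun t ht => (hd t ht).differentiableAt.differentiableWithinAt) fun t ht => ?_
  rw [(hd t ht).deriv]
  rw [interior_Icc] at ht
  exact gateField_nonneg hs ht.1.le _

/-- A gate with positive parameter lifts everything above its lower end to its upper end: the
solution leaves the lower end, and if it did not reach the upper end, then `arcsin (2 (ψ - a) - 1)`
would grow by more than `π`. -/
lemma IsPath.le_apply_windowStart_succ (hs : ∀ N i, 0 ≤ s N i) (h : IsPath (gateField s) T ψ)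
    (hT : windowStart N (i + 1) ≤ T) (hψ : (i - N : ℝ) ≤ ψ (windowStart N i)) (hpos : 0 < s N i) :
    (i + 1 - N : ℝ) ≤ ψ (windowStart N (i + 1)) := by
  set t₀ := windowStart N i with ht₀
  set t₁ := windowStart N (i + 1) with ht₁
  set a : ℝ := i - N with ha
  have h01 : t₀ < t₁ := windowStart_lt_succ N i
  have h1 : 1 ≤ t₀ := one_le_windowStart N i
  set l : ℝ := (1 / 2) ^ (i + 1) with hl
  have hl0 : 0 < l := by positivity
  have htl : t₁ = t₀ + l := windowStart_succ N i
  by_contra hlt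
  replace hlt : ψ t₁ < a + 1 := by rw [ha]; linarith [not_le.1 hlt]
  have hmono := h.monotoneOn hs
  have hlow : ∀ t ∈ Icc t₀ t₁, a ≤ ψ t := fun t ht =>
    hψ.trans (hmono ⟨h1, h01.le.trans hT⟩ ⟨h1.trans ht.1, ht.2.trans hT⟩ ht.1)
  have hup : ∀ t ∈ Icc t₀ t₁, ψ t < a + 1 := fun t ht =>
    (hmono ⟨h1.trans ht.1, ht.2.trans hT⟩ ⟨h1.trans h01.le, hT⟩ ht.2).trans_lt hlt
  have hd : ∀ t ∈ Ioo t₀ t₁, HasDerivAt ψ (gate N i (s N i) (t, ψ t)) t := fun t ht => by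
    rw [← gateField_of_mem_window ⟨ht.1.le, ht.2.le⟩]
    exact h.hasDerivAt ⟨one_pos.trans_le (h1.trans ht.1.le), ht.2.trans_le hT⟩
  have hstrict : StrictMonoOn ψ (Icc t₀ t₁) := by
    refine strictMonoOn_of_deriv_pos (convex_Icc _ _) ψ.continuous.continuousOn fun t ht => ?_
    rw [interior_Icc] at ht
    rw [(hd t ht).deriv]
    have e1 := hlow t ⟨ht.1.le, ht.2.le⟩
    have e2 := hup t ⟨ht.1.le, ht.2.le⟩
    refine mul_pos (pulse_pos ht) (add_pos_of_nonneg_of_pos (Real.sqrt_nonneg _)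
      (mul_pos hpos (lt_max_of_lt_right ?_)))
    rw [← ha, sub_pos, abs_lt]
    constructor <;> linarith
  have hin : ∀ t ∈ Ioo t₀ t₁, 2 * (ψ t - a) - 1 ∈ Ioo (-1 : ℝ) 1 := fun t ht => by
    have e1 := hψ.trans_lt (hstrict ⟨le_rfl, h01.le⟩ ⟨ht.1.le, ht.2.le⟩ ht.1)
    have e2 := hup t ⟨ht.1.le, ht.2.le⟩
    constructor <;> linarith
  have hsub : Icc (t₀ + l / 4) (t₀ + 3 * l / 4) ⊆ Ioo t₀ t₁ := fun t ht =>
    ⟨by linarith [ht.1], by linarith [ht.2]⟩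
  have hda : ∀ t ∈ Ioo t₀ t₁, HasDerivAt (fun t => Real.arcsin (2 * (ψ t - a) - 1))
      (1 / √(1 - (2 * (ψ t - a) - 1) ^ 2) * (2 * gate N i (s N i) (t, ψ t))) t := fun t ht =>
    HasDerivAt.comp (h₂ := Real.arcsin) t
      (Real.hasDerivAt_arcsin (hin t ht).1.ne' (hin t ht).2.ne)
      ((((hd t ht).sub_const a).const_mul 2).sub_const 1)
  have hgrow := (convex_Icc (t₀ + l / 4) (t₀ + 3 * l / 4)).mul_sub_le_image_sub_of_le_deriv
    (f := fun t => Real.arcsin (2 * (ψ t - a) - 1)) (by fun_prop)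
    (fun t ht => (hda t (hsub (interior_subset ht))).differentiableAt.differentiableWithinAt)
    (C := 8 * 2 ^ (i + 1)) (fun t ht => by
      replace ht := interior_subset ht
      have hio := hin t (hsub ht)
      rw [(hda t (hsub ht)).deriv]
      set w := 2 * (ψ t - a) - 1 with hw
      have hsq : 0 < √(1 - w ^ 2) := Real.sqrt_pos.2 (by nlinarith [hio.1, hio.2])
      have e1 : 4 * 2 ^ (i + 1) * √(1 - w ^ 2) ≤ gate N i (s N i) (t, ψ t) := by
        refine mul_le_mul (le_pulse ht.1 ht.2) (le_add_of_nonneg_right ?_) hsq.le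
          (pulse_nonneg _ _ _)
        have := hs N i
        positivity
      rw [one_div, inv_mul_eq_div, le_div_iff₀ hsq]
      linarith)
    (t₀ + l / 4) ⟨le_rfl, by linarith⟩ (t₀ + 3 * l / 4) ⟨by linarith, le_rfl⟩ (by linarith)
  have e1 : 8 * 2 ^ (i + 1) * (t₀ + 3 * l / 4 - (t₀ + l / 4)) = 4 := by
    have : (2 : ℝ) ^ (i + 1) * l = 1 := by rw [hl, ← mul_pow]; norm_num
    linear_combination 4 * this
  rw [e1] at hgrow
  have e2 := Real.arcsin_le_pi_div_two (2 * (ψ (t₀ + 3 * l / 4) - a) - 1)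
  have e3 := Real.neg_pi_div_two_le_arcsin (2 * (ψ (t₀ + l / 4) - a) - 1)
  linarith [Real.pi_lt_four]

/-- Consecutive gates with positive parameters lift everything above the lower end of the first one
to the upper end of the last one. -/
lemma IsPath.le_apply_windowStart (hs : ∀ N i, 0 ≤ s N i) (h : IsPath (gateField s) T ψ)
    {i₀ : ℕ} (hψ : (i₀ - N : ℝ) ≤ ψ (N + 1)) (hi : i₀ ≤ i) (hT : windowStart N i ≤ T)
    (hpos : ∀ j, i₀ ≤ j → j < i → 0 < s N j) : (i - N : ℝ) ≤ ψ (windowStart N i) := by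
  have hmono := h.monotoneOn hs
  induction i, hi using Nat.le_induction with
  | base =>
    refine hψ.trans (hmono ⟨by simp, (le_windowStart _ _).trans hT⟩ ⟨one_le_windowStart _ _, hT⟩
      (le_windowStart _ _))
  | succ i hi ih =>
    push_cast
    exact h.le_apply_windowStart_succ hs hT
      (ih ((windowStart_lt_succ N i).le.trans hT)
        fun j h1 h2 => hpos j h1 (h2.trans i.lt_succ_self))
      (hpos i hi i.lt_succ_self)

/-- From the lower end of a gate with positive parameter some solution arrives exactly at the upper
end: it can be stopped there, as the upper end is stationary. -/
lemma IsPath.exists_climb (hs : ∀ N i, 0 ≤ s N i) (h : IsPath (gateField s) (windowStart N i) ψ)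
    (hψ : ψ (windowStart N i) = i - N) (hpos : 0 < s N i) :
    ∃ ψ', IsPath (gateField s) (windowStart N (i + 1)) ψ' ∧
      (∀ t ≤ windowStart N i, ψ' t = ψ t) ∧ ψ' (windowStart N (i + 1)) = i + 1 - N := by
  have h01 := (windowStart_lt_succ N i).le
  have h1 := one_le_windowStart N i
  have h0 : 0 ≤ windowStart N i := zero_le_one.trans h1
  set a : ℝ := i - N with ha
  obtain ⟨T, hT, ψ₁, g1, g2, -, g4⟩ := h.exists_extension (M := |a| + 1) h0 h01
    (by rw [hψ]; linarith)
  have hreach : a + 1 ≤ ψ₁ T := by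
    rcases g4 with rfl | g4
    · have := g1.le_apply_windowStart_succ hs le_rfl (by rw [g2 _ le_rfl, hψ]) hpos
      rw [ha]; linarith
    · have e1 : a ≤ ψ₁ T := by
        rw [← hψ, ← g2 _ le_rfl]
        exact g1.monotoneOn hs ⟨h1, hT.1⟩ ⟨h1.trans hT.1, le_rfl⟩ hT.1
      rcases abs_cases (ψ₁ T) with ⟨e2, e3⟩ | ⟨e2, e3⟩
      · linarith [le_abs_self a]
      · linarith [neg_abs_le a]
  obtain ⟨c, hc, hc1, -⟩ := exists_first_crossing (g := fun _ => a + 1) ψ₁.continuous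
    continuous_const hT.1 (by rw [g2 _ le_rfl, hψ]; linarith) hreach
  have hz : a + 1 = (((i : ℤ) - N + 1 : ℤ) : ℝ) := by rw [ha]; push_cast; ring
  obtain ⟨ψ', e1, e2, e3⟩ := (g1.mono hc.2).append_const (h0.trans hc.1) (hc.2.trans hT.2)
    fun t ht => by
      rw [hc1, hz, gateField_of_mem_window ⟨hc.1.trans ht.1, ht.2⟩]
      exact gate_intCast fun hne => by omega
  refine ⟨ψ', e1, fun t ht => by rw [e2 t (ht.trans hc.1), g2 t ht], ?_⟩
  rw [e3 _ ⟨hc.2.trans hT.2, le_rfl⟩, hc1, ha]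
  ring

/-- If the gates between the integers `p` and `q` have positive parameters, and the one with lower
end `q` has parameter `0`, then a solution can pass from `p` to `q` during the stage: it waits at
`p`, is lifted to `q`, and waits at `q`. -/
lemma IsPath.exists_stage (hs : ∀ N i, 0 ≤ s N i) (h : IsPath (gateField s) (N + 1) ψ) {p q : ℤ}
    (hp : ψ (N + 1) = p) (hpq : p ≤ q) (hpN : p < q → -(N : ℤ) ≤ p)
    (hpos : ∀ j : ℕ, p ≤ (j : ℤ) - N → (j : ℤ) - N < q → 0 < s N j)
    (hzero : ∀ j : ℕ, (j : ℤ) - N = q → s N j = 0) :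
    ∃ ψ', IsPath (gateField s) (N + 2) ψ' ∧ (∀ t ≤ (N + 1 : ℝ), ψ' t = ψ t) ∧
      ψ' (N + 2) = q := by
  suffices hclimb : ∃ i, ∃ ψ₁, IsPath (gateField s) (windowStart N i) ψ₁ ∧
      (∀ t ≤ (N + 1 : ℝ), ψ₁ t = ψ t) ∧ ψ₁ (windowStart N i) = q by
    obtain ⟨i, ψ₁, g1, g2, g3⟩ := hclimb
    obtain ⟨ψ', e1, e2, e3⟩ := g1.append_const (T := (N : ℝ) + 2)
      (zero_le_one.trans (one_le_windowStart N i)) (windowStart_lt N i).le fun t ht => by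
        rw [g3]
        exact gateField_intCast ht fun j _ hj => Or.inl (hzero j hj)
    exact ⟨ψ', e1, fun t ht => by rw [e2 t (ht.trans (le_windowStart N i)), g2 t ht], by
      rw [e3 _ ⟨(windowStart_lt N i).le, le_rfl⟩, g3]⟩
  rcases hpq.eq_or_lt with rfl | hlt
  · exact ⟨0, ψ, by rwa [windowStart_zero], fun _ _ => rfl, by rwa [windowStart_zero]⟩
  obtain ⟨i₀, hi₀⟩ : ∃ i₀ : ℕ, (i₀ : ℤ) - N = p :=
    ⟨(p + N).toNat, by have := hpN hlt; omega⟩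
  have hclimb : ∀ d : ℕ, p + d ≤ q → ∃ ψ₁, IsPath (gateField s) (windowStart N (i₀ + d)) ψ₁ ∧
      (∀ t ≤ (N + 1 : ℝ), ψ₁ t = ψ t) ∧ ψ₁ (windowStart N (i₀ + d)) = ((p + d : ℤ) : ℝ) := by
    intro d
    induction d with
    | zero =>
      intro _
      obtain ⟨ψ', e1, e2, e3⟩ := h.append_const (T := windowStart N i₀) (by positivity)
        (le_windowStart N _) fun t ht => by
          rw [hp]
          refine gateField_intCast (i := 0) (N := N) ⟨by rw [windowStart_zero]; exact ht.1,
            ht.2.trans (windowStart_lt N _).le⟩ fun j _ hj => Or.inr ?_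
          rw [show j = i₀ by omega]
          exact ht.2
      exact ⟨ψ', e1, e2, by rw [add_zero, e3 _ ⟨le_windowStart N _, le_rfl⟩, hp]; simp⟩
    | succ d ih =>
      intro hd
      push_cast at hd
      obtain ⟨ψ₁, g1, g2, g3⟩ := ih (by omega)
      have hcast : ((p + d : ℤ) : ℝ) = ((i₀ + d : ℕ) : ℝ) - N := by
        rw [← hi₀]; push_cast; ring
      obtain ⟨ψ', e1, e2, e3⟩ := g1.exists_climb hs (by rw [g3, hcast])
        (hpos (i₀ + d) (by omega) (by omega))
      refine ⟨ψ', e1, fun t ht => by rw [e2 t (ht.trans (le_windowStart N _)), g2 t ht], ?_⟩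
      rw [← add_assoc, e3, ← hi₀]
      push_cast
      ring
  obtain ⟨ψ₁, g⟩ := hclimb (q - p).toNat (by omega)
  refine ⟨_, ψ₁, g.1, g.2.1, ?_⟩
  rw [g.2.2]
  congr 1
  omega

end GateDynamics

section GateSolvability

variable {s : ℕ → ℕ → ℝ}

lemma exists_funnel_path (s : ℕ → ℕ → ℝ) (k : ℕ) :
    ∃ ψ, IsPath (gateField s) 1 ψ ∧ ψ 1 = -k := by
  set r : ℝ := √k with hr
  have hr0 : 0 ≤ r := Real.sqrt_nonneg _
  -- `P' = 12 t (1 - t)`, and `-(u / (1 - u)) ^ 2` with `u = P t - P t₀` leaves `0` at time `t₀`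
  let P : ℝ → ℝ := fun t => 6 * t ^ 2 - 4 * t ^ 3
  have hmono : ∀ a b, 0 ≤ a → a ≤ b → b ≤ 1 → P a ≤ P b := by
    intro a b ha hab hb
    have h1 : 0 ≤ 6 * (b + a) - 4 * (b ^ 2 + a * b + a ^ 2) := by nlinarith
    have h2 : P b - P a = (b - a) * (6 * (b + a) - 4 * (b ^ 2 + a * b + a ^ 2)) := by
      simp only [P]; ring
    have := mul_nonneg (sub_nonneg.2 hab) h1
    linarith
  have hu₀ : r / (1 + r) < 1 := by rw [div_lt_one (by positivity)]; linarith
  have hu₀' : 0 ≤ r / (1 + r) := by positivity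
  obtain ⟨t₀, ht₀, hP⟩ := intermediate_value_Icc (f := P) (zero_le_one' ℝ)
    (by simp only [P]; fun_prop) (show 2 - r / (1 + r) ∈ Icc (P 0) (P 1) by
      constructor <;> norm_num [P] <;> linarith)
  have hP1 : P 1 = 2 := by norm_num [P]
  have h0 : IsPath (gateField s) 0 0 := fun t ht => by
    obtain rfl : t = 0 := le_antisymm ht.2 ht.1
    simp
  obtain ⟨ψ₀, h1, -, h3⟩ := h0.append_const le_rfl ht₀.1 fun t ht => by
    rw [gateField_of_le_one (ht.2.trans ht₀.2)]
    exact funnel_zero t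
  have hψ₀ : ψ₀ t₀ = 0 := h3 t₀ ⟨ht₀.1, le_rfl⟩
  let u : ℝ → ℝ := fun t => P t - P t₀
  obtain ⟨ψ, g1, -, g3⟩ := h1.append_of_hasDerivAt (T := 1) (σ := fun t => -(u t / (1 - u t)) ^ 2)
    ht₀.1 ht₀.2 (by simp [u, hψ₀]) fun t ht => by
      have hut0 : 0 ≤ u t := sub_nonneg.2 (hmono _ _ ht₀.1 ht.1 ht.2)
      have hut1 : 0 < 1 - u t := by
        have := hmono t 1 (ht₀.1.trans ht.1) ht.2 le_rfl
        simp only [u]; linarith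
      have hu : HasDerivAt u (12 * (t * (1 - t))) t := by
        have := (((hasDerivAt_pow 2 t).const_mul 6).sub ((hasDerivAt_pow 3 t).const_mul 4))
          |>.sub_const (P t₀)
        exact this.congr_deriv (by push_cast; ring)
      have hw := ((hu.div (hu.const_sub 1) hut1.ne').pow 2).neg
      have hw0 : 0 ≤ u t / (1 - u t) := by positivity
      have hsqrt : √(-(-(u t / (1 - u t)) ^ 2)) = u t / (1 - u t) := by
        rw [neg_neg, Real.sqrt_sq hw0]
      have htt : 0 ≤ t * (1 - t) := mul_nonneg (ht₀.1.trans ht.1) (by linarith [ht.2])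
      rw [gateField_of_le_one ht.2]
      simp only [funnel]
      rw [hsqrt, max_eq_right htt]
      refine hw.congr_deriv ?_
      have hne := hut1.ne'
      simp only [Pi.div_apply]
      obtain ⟨v, hv⟩ : ∃ v, u t = 1 - v := ⟨1 - u t, by ring⟩
      rw [hv, sub_sub_cancel] at hne
      rw [hv, sub_sub_cancel, Nat.cast_ofNat, show 2 - 1 = 1 from rfl, pow_one]
      field_simp
      ring
  refine ⟨ψ, g1, ?_⟩
  have hu1 : u 1 = r / (1 + r) := by simp only [u]; rw [hP1, hP]; ring
  have hw1 : u 1 / (1 - u 1) = r := by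
    rw [hu1]
    field_simp
    ring
  rw [g3 1 ⟨ht₀.2, le_rfl⟩, hw1, hr, Real.sq_sqrt k.cast_nonneg]

/-- Call a gate closed if its parameter is `0`, and suppose that in the stage `N` the closed gates
are those with lower ends `h k (N + 1) - k` for `k ≤ N`. Then a solution is trapped above one of the
lanes `N ↦ h k N - k`, and it can follow the lane as long as it is finite. -/
lemma gateField_mem_rightSolvable_iff {h : ℕ → ℕ → ℕ∞} (hmono : ∀ k N, h k N ≤ h k (N + 1))
    (hanti : ∀ k N, h (k + 1) N ≤ h k N) (hdiag : ∀ k N, h (k + 1) (N + 1) ≤ h k N)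
    (hzero : ∀ k N, N ≤ k → h k N = 0) (hs : ∀ N i, 0 ≤ s N i)
    (hs0 : ∀ N i, s N i = 0 ↔ ∃ k ≤ N, ∃ m : ℕ, m + N = i + k ∧ h k (N + 1) = m) :
    gateField s ∈ rightSolvable ↔ ∃ k, ∀ N, h k N ≠ ⊤ := by
  -- between two consecutive positions of a lane there are no closed gates
  have hkey : ∀ k N n j : ℕ, h k N = n → n + N ≤ j + k →
      ((j + k : ℕ) : ℕ∞) < h k (N + 1) + N → 0 < s N j := by
    intro k N n j hn hnj hj
    refine (hs N j).lt_of_ne fun h0 => ?_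
    obtain ⟨k', hk', m, hm, hm'⟩ := (hs0 N j).1 h0.symm
    have hant : Antitone fun k => h k (N + 1) := antitone_nat_of_succ_le fun k => hanti k (N + 1)
    rcases le_or_gt k' k with hkk | hkk
    · have h1 : h k (N + 1) ≤ m := hm' ▸ hant hkk
      have h2 : ((j + k : ℕ) : ℕ∞) < ((m + N : ℕ) : ℕ∞) := by
        push_cast at hj ⊢
        exact hj.trans_le (add_le_add_left h1 _)
      have : j + k < m + N := by exact_mod_cast h2
      omega
    · have h1 : h k' (N + 1) ≤ n := hn ▸
        (hant hkk).trans (hdiag k N)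
      rw [hm'] at h1
      have : m ≤ n := by exact_mod_cast h1
      omega
  constructor
  · rintro ⟨ψ, hψ⟩
    -- the lane `k` starts at `-k`, hence below `ψ 1`
    obtain ⟨k, hk⟩ := exists_nat_ge (-ψ 1)
    have hψm : ∀ a b, 1 ≤ a → a ≤ b → ψ a ≤ ψ b := fun a b ha hab =>
      (hψ b).monotoneOn hs ⟨ha, hab⟩ ⟨ha.trans hab, le_rfl⟩ hab
    refine ⟨k, fun N => ?_⟩
    suffices hN : ∃ n : ℕ, h k N = n ∧ (n - k : ℝ) ≤ ψ (N + 1) by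
      obtain ⟨n, hn, -⟩ := hN
      simp [hn]
    induction N with
    | zero =>
      refine ⟨0, by simpa using hzero k 0 k.zero_le, ?_⟩
      norm_num
      linarith
    | succ N ih =>
      obtain ⟨n, hn, hnψ⟩ := ih
      rw [show (((N + 1 : ℕ) : ℝ) + 1) = N + 2 by push_cast; ring]
      rcases lt_or_ge N k with hNk | hNk
      · refine ⟨0, by simpa using hzero k (N + 1) hNk, ?_⟩
        rw [hzero k N hNk.le] at hn
        have hn0 : (0 : ℝ) ≤ n := n.cast_nonneg
        have := hψm (N + 1) (N + 2) (by simp) (by linarith)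
        push_cast
        linarith
      · have hi₀ : ((n + N - k : ℕ) : ℝ) - N = n - k := by
          rw [Nat.cast_sub (by omega)]; push_cast; ring
        have hlift : ∀ i, n + N - k ≤ i → (∀ j, n + N - k ≤ j → j < i →
            ((j + k : ℕ) : ℕ∞) < h k (N + 1) + N) → (i - N : ℝ) ≤ ψ (N + 2) := by
          intro i hi hj
          refine ((hψ (windowStart N i)).le_apply_windowStart hs (by rw [hi₀]; exact hnψ) hi le_rfl
            fun j h1 h2 => hkey k N n j hn (by omega) (hj j h1 h2)).trans ?_
          exact hψm _ _ (one_le_windowStart N i) (windowStart_lt N i).le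
        cases hn' : h k (N + 1) with
        | top =>
          obtain ⟨i, hi⟩ := exists_nat_gt (ψ (N + 2) + N)
          have := hlift (max i (n + N - k)) (le_max_right _ _) fun j _ _ => by
            rw [hn', top_add]
            exact ENat.natCast_lt_top _
          have h2 : (i : ℝ) ≤ (max i (n + N - k) : ℕ) := Nat.cast_le.2 (le_max_left _ _)
          linarith
        | coe n' =>
          have hnn : n ≤ n' := by
            have := hmono k N
            rw [hn, hn'] at this
            exact_mod_cast this
          have := hlift (n' + N - k) (by omega) fun j _ h2 => by
            rw [hn']
            exact_mod_cast (by omega : j + k < n' + N)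
          rw [Nat.cast_sub (by omega)] at this
          push_cast at this
          exact ⟨n', rfl, by linarith⟩
  · rintro ⟨k, hk⟩
    have hg : ∀ N, ∃ n : ℕ, h k N = n := fun N => ⟨_, (ENat.natCast_toNat (hk N)).symm⟩
    choose g hg using hg
    have hgm : ∀ N, g N ≤ g (N + 1) := fun N => by
      have := hmono k N
      rw [hg, hg] at this
      exact_mod_cast this
    have hg0 : ∀ N, N ≤ k → g N = 0 := fun N hN => by
      have := hzero k N hN
      rw [hg] at this
      exact_mod_cast this
    obtain ⟨ψ₀, hψ₀, hψ₀1⟩ := exists_funnel_path s k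
    obtain ⟨χ, -, hχ, hext⟩ := exists_chain (a := ψ₀)
      (fun N ψ => IsPath (gateField s) ((N : ℝ) + 1) ψ ∧
        ψ ((N : ℝ) + 1) = (((g N : ℤ) - k : ℤ) : ℝ))
      (fun N ψ ψ' => ∀ t ≤ (N : ℝ) + 1, ψ' t = ψ t)
      (by simpa [hg0 0 k.zero_le] using ⟨hψ₀, hψ₀1⟩) (by
        rintro N ψ ⟨h1, h2⟩
        have hkN : g N < g (N + 1) → k ≤ N := fun hlt => by
          by_contra hle
          rw [hg0 (N + 1) (by omega)] at hlt
          omega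
        have := hgm N
        obtain ⟨ψ', e1, e2, e3⟩ := h1.exists_stage hs (q := (g (N + 1) : ℤ) - k) h2 (by omega)
          (fun hlt => by have := hkN (by omega); omega)
          (fun j hj1 hj2 => hkey k N (g N) j (hg N) (by omega) (by
            rw [hg]
            exact_mod_cast (by omega : j + k < g (N + 1) + N)))
          (fun j hj => (hs0 N j).2 (by
            rcases le_or_gt k N with hle | hlt
            · exact ⟨k, hle, g (N + 1), by omega, hg (N + 1)⟩
            · rw [hg0 (N + 1) hlt] at hj
              omega))
        have hN : (((N + 1 : ℕ) : ℝ) + 1) = N + 2 := by push_cast; ring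
        exact ⟨ψ', ⟨by rwa [hN], by rwa [hN]⟩, e2⟩)
    refine rightSolvable_of_extensions (T := fun N => (N : ℝ) + 1) (fun a b hab => ?_)
      (tendsto_atTop_add_const_right _ _ tendsto_natCast_atTop_atTop) (fun N => (hχ N).1) hext
    have : (a : ℝ) ≤ b := Nat.cast_le.2 hab
    simpa using this

lemma mem_globallySolvable_gateField :
    ((gateField s, (0, 0)) : CauchyProblem) ∈ globallySolvable ↔ gateField s ∈ rightSolvable := by
  have h1 : sideField 1 (gateField s, (0, 0)) = gateField s := by
    ext p; simp [sideField]
  constructor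
  · rintro ⟨φ, hφ⟩
    rw [← h1]
    exact sideField_mem_rightSolvable hφ 1
  · intro h
    refine exists_isGlobalSolution (by rwa [h1]) ⟨0, fun T t ht => ?_⟩
    have h2 : ∀ u ∈ uIcc 0 t, sideField (-1) (gateField s, (0, 0)) (u, (0 : C(ℝ, ℝ)) u) = 0 := by
      intro u hu
      rw [uIcc_of_le ht.1] at hu
      simp [sideField, gateField_of_le_one (show -u ≤ 1 by linarith [hu.1]), funnel_zero]
    rw [intervalIntegral.integral_congr h2]
    simp

end GateSolvability

/-! ### Counting functions on zero-dimensional spaces -/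

/-- The function takes each finite value on a closed set. -/
def HasClosedLevels {X : Type*} [TopologicalSpace X] (u : X → ℕ∞) : Prop :=
  ∀ m : ℕ, IsClosed {x | u x = m}

section Counting

variable {X : Type u} [TopologicalSpace X]

lemma HasClosedLevels.add {u v : X → ℕ∞} (hu : HasClosedLevels u) (hv : HasClosedLevels v) :
    HasClosedLevels (u + v) := by
  intro m
  have h : {x | (u + v) x = m} =
      ⋃ p ∈ Finset.HasAntidiagonal.antidiagonal m,
        {x | u x = (p.1 : ℕ)} ∩ {x | v x = (p.2 : ℕ)} := by
    ext x
    simp only [Pi.add_apply, mem_ofPred_eq, mem_iUnion, mem_inter_iff,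
      Finset.HasAntidiagonal.mem_antidiagonal, exists_prop, Prod.exists]
    constructor
    · intro h
      cases ha : u x with
      | top => simp [ha] at h
      | coe a =>
        cases hb : v x with
        | top => simp [hb] at h
        | coe b =>
          rw [ha, hb] at h
          exact ⟨a, b, by exact_mod_cast h, rfl, rfl⟩
    · rintro ⟨a, b, hab, ha, hb⟩
      rw [ha, hb, ← hab, Nat.cast_add]
  rw [h]
  exact isClosed_biUnion_finset fun p _ => (hu _).inter (hv _)

lemma HasClosedLevels.sum {ι : Type*} (s : Finset ι) {u : ι → X → ℕ∞}
    (hu : ∀ i, HasClosedLevels (u i)) : HasClosedLevels (∑ i ∈ s, u i) := by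
  classical
  induction s using Finset.induction_on with
  | empty =>
    intro m
    rcases eq_or_ne m 0 with rfl | hm
    · simp
    · have : {x : X | (∑ i ∈ (∅ : Finset ι), u i) x = m} = ∅ := by
        ext x
        simp only [Finset.sum_empty, Pi.zero_apply, mem_ofPred_eq, mem_empty_iff_false, iff_false]
        exact_mod_cast hm.symm
      rw [this]
      exact isClosed_empty
  | insert i s hi ih => rw [Finset.sum_insert hi]; exact (hu i).add ih

lemma IsZeroDimensional.exists_isClopen_of_isOpen [SecondCountableTopology X]
    (hX : IsZeroDimensional X) {U : Set X} (hU : IsOpen U) :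
    ∃ W : ℕ → Set X, (∀ n, IsClopen (W n)) ∧ Pairwise (Function.onFun Disjoint W) ∧
      ⋃ n, W n = U := by
  obtain ⟨S, hS, rfl⟩ := TopologicalSpace.IsTopologicalBasis.open_eq_sUnion hX hU
  obtain ⟨T, hT, hTS, hTU⟩ := TopologicalSpace.isOpen_sUnion_countable S fun s hs => (hS hs).isOpen
  obtain ⟨V, hV⟩ := (hT.insert ∅).exists_eq_range (insert_nonempty _ _)
  have hVc : ∀ n, IsClopen (V n) := fun n => by
    have : V n ∈ insert ∅ T := hV ▸ mem_range_self n
    rcases this with h | h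
    · rw [h]; exact isClopen_empty
    · exact hS (hTS h)
  refine ⟨disjointed V, fun n => ?_, disjoint_disjointed V, ?_⟩
  · exact disjointedRec (p := IsClopen) (fun t i ht => ht.diff (hVc i)) (hVc n)
  · rw [iUnion_disjointed, ← hTU, ← sUnion_range, ← hV, sUnion_insert, empty_union]

/-- An `F_σ` set in a zero-dimensional space is a countable disjoint union of closed sets; the
function maps a point to the index of its closed set. -/
lemma IsFSigma.exists_hasClosedLevels [SecondCountableTopology X] (hX : IsZeroDimensional X)
    {E : Set X} (hE : IsFSigma E) :
    ∃ u : X → ℕ∞, HasClosedLevels u ∧ ∀ x, u x ≠ ⊤ ↔ x ∈ E := by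
  classical
  obtain ⟨F, hF, rfl⟩ := hE
  have hU : ∀ m : ℕ, IsOpen (⋃ m' ∈ Finset.range m, F m')ᶜ := fun m =>
    (isClosed_biUnion_finset fun i _ => hF i).isOpen_compl
  choose W hW hWd hWU using fun m => hX.exists_isClopen_of_isOpen (hU m)
  let D : ℕ → Set X := fun n => F n.unpair.1 ∩ W n.unpair.1 n.unpair.2
  have hD : ∀ n, IsClosed (D n) := fun n => (hF _).inter (hW _ _).isClosed
  have hlt : ∀ x m m' l, x ∈ F m → x ∈ W m' l → m' ≤ m := by
    intro x m m' l h1 h2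
    by_contra hlt
    have h3 : x ∈ (⋃ m'' ∈ Finset.range m', F m'')ᶜ := hWU m' ▸ mem_iUnion_of_mem l h2
    exact h3 (mem_biUnion (Finset.mem_coe.2 (Finset.mem_range.2 (not_le.1 hlt))) h1)
  have huniq : ∀ x n n', x ∈ D n → x ∈ D n' → n = n' := by
    intro x n n' h h'
    have h1 : n.unpair.1 = n'.unpair.1 :=
      le_antisymm (hlt x _ _ _ h'.1 h.2) (hlt x _ _ _ h.1 h'.2)
    have h2 : n.unpair.2 = n'.unpair.2 := by
      by_contra hne
      refine disjoint_left.1 (hWd n.unpair.1 hne) h.2 ?_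
      rw [h1]
      exact h'.2
    rw [← Nat.pair_unpair n, ← Nat.pair_unpair n', h1, h2]
  have hex : ∀ x, x ∈ ⋃ m, F m → ∃ n, x ∈ D n := by
    intro x hx
    have hx' : ∃ m, x ∈ F m := mem_iUnion.1 hx
    have h1 : x ∈ (⋃ m' ∈ Finset.range (Nat.find hx'), F m')ᶜ := by
      simp only [mem_compl_iff, mem_iUnion, Finset.mem_range, exists_prop, not_exists, not_and]
      exact fun m hm => Nat.find_min hx' hm
    rw [← hWU, mem_iUnion] at h1
    obtain ⟨l, hl⟩ := h1
    exact ⟨Nat.pair (Nat.find hx') l, by simpa [D] using ⟨Nat.find_spec hx', hl⟩⟩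
  let u : X → ℕ∞ := fun x => if h : ∃ n, x ∈ D n then ((Nat.find h : ℕ) : ℕ∞) else ⊤
  have hu : ∀ x (m : ℕ), u x = m ↔ x ∈ D m := by
    intro x m
    by_cases h : ∃ n, x ∈ D n
    · simp only [u, dif_pos h, Nat.cast_inj]
      exact ⟨fun e => e ▸ Nat.find_spec h, fun hm => huniq x _ _ (Nat.find_spec h) hm⟩
    · simp only [u, dif_neg h]
      exact ⟨fun e => absurd e (ENat.top_ne_natCast m), fun hm => absurd ⟨m, hm⟩ h⟩
  refine ⟨u, fun m => ?_, fun x => ?_⟩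
  · simp only [hu]
    exact hD m
  · rw [ENat.ne_top_iff_exists]
    constructor
    · rintro ⟨m, hm⟩
      exact mem_iUnion_of_mem _ ((hu x m).1 hm.symm).1
    · intro hx
      obtain ⟨m, hm⟩ := hex x hx
      exact ⟨m, ((hu x m).2 hm).symm⟩

/-- A `Σ⁰₄` set is an increasing union of `Π⁰₃` sets. -/
lemma IsSigmaFour.exists_increasing {B : Set X} (hB : IsSigmaFour B) :
    ∃ E : ℕ → ℕ → Set X, (∀ k i, IsFSigma (E k i)) ∧ (∀ k, ⋂ i, E k i ⊆ ⋂ i, E (k + 1) i) ∧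
      B = ⋃ k, ⋂ i, E k i := by
  obtain ⟨A, hA, rfl⟩ := hB
  choose E hE hAE using hA
  refine ⟨fun k i => ⋃ k' : ℕ, ⋃ _ : k' ≤ k, ⋂ i' ∈ Finset.range (i + 1), E k' i', fun k i =>
    .iUnion fun k' => .iUnion fun _ => .biInter_finset _ fun i' => hE k' i', fun k => ?_, ?_⟩
  · refine iInter_mono fun i => iUnion_mono fun k' => iUnion_subset fun hk' => ?_
    exact subset_iUnion_of_subset (hk'.trans k.le_succ) subset_rfl
  · ext x
    simp only [hAE, mem_iUnion, mem_iInter, Finset.mem_range, exists_prop]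
    constructor
    · rintro ⟨k, hk⟩
      exact ⟨k, fun i => ⟨k, le_rfl, fun i' _ => hk i'⟩⟩
    · rintro ⟨k, hk⟩
      -- some `k' ≤ k` occurs for infinitely many `i`
      by_contra! hne
      choose g hg using hne
      obtain ⟨k', hk', h⟩ := hk ((Finset.range (k + 1)).sup g)
      exact hg k' (h (g k') (Nat.lt_succ_of_le
        (Finset.le_sup (Finset.mem_range.2 (Nat.lt_succ_of_le hk')))))

/-- The height of the lane `k` at the beginning of the stage `N`: it collects the values of the
counting functions with first index at least `k`. -/
def laneHeight (w : ℕ → ℕ → ℕ∞) (k N : ℕ) : ℕ∞ :=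
  ∑ c ∈ (Finset.range (N - k)).filter (fun c => k ≤ c.unpair.1), w c.unpair.1 c.unpair.2

variable {w : ℕ → ℕ → ℕ∞} {k N : ℕ}

lemma laneHeight_le_succ : laneHeight w k N ≤ laneHeight w k (N + 1) := by
  refine Finset.sum_le_sum_of_subset fun c hc => ?_
  simp only [Finset.mem_filter, Finset.mem_range] at hc ⊢
  omega

lemma laneHeight_succ_le : laneHeight w (k + 1) N ≤ laneHeight w k N := by
  refine Finset.sum_le_sum_of_subset fun c hc => ?_
  simp only [Finset.mem_filter, Finset.mem_range] at hc ⊢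
  omega

lemma laneHeight_succ_succ_le : laneHeight w (k + 1) (N + 1) ≤ laneHeight w k N := by
  refine Finset.sum_le_sum_of_subset fun c hc => ?_
  simp only [Finset.mem_filter, Finset.mem_range] at hc ⊢
  omega

lemma laneHeight_eq_zero (h : N ≤ k) : laneHeight w k N = 0 := by
  simp [laneHeight, Nat.sub_eq_zero_of_le h]

lemma forall_laneHeight_ne_top :
    (∀ N, laneHeight w k N ≠ ⊤) ↔ ∀ k', k ≤ k' → ∀ i, w k' i ≠ ⊤ := by
  have hsum : ∀ s : Finset ℕ, ∑ c ∈ s, w c.unpair.1 c.unpair.2 ≠ ⊤ ↔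
      ∀ c ∈ s, w c.unpair.1 c.unpair.2 ≠ ⊤ := fun s => by simp
  simp only [laneHeight, hsum, Finset.mem_filter, Finset.mem_range]
  constructor
  · intro h k' hk' i
    simpa using h (Nat.pair k' i + 1 + k) (Nat.pair k' i) ⟨by omega, by simpa using hk'⟩
  · exact fun h N c hc => h _ hc.2 _

end Counting

/-! ### Hardness -/

lemma isSigmaZeroHard_globallySolvable : IsSigmaZeroHard.{u, 0} 4 globallySolvable := by
  intro X _ _ hX B hB
  obtain ⟨E, hE, hEk, rfl⟩ := hB.isSigmaFour.exists_increasing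
  choose w hw hwE using fun k i => (hE k i).exists_hasClosedLevels hX
  let h : X → ℕ → ℕ → ℕ∞ := fun x => laneHeight fun k i => w k i x
  have hlev : ∀ k N, HasClosedLevels fun x => h x k N := fun k N => by
    simpa only [h, laneHeight, Finset.sum_fn] using HasClosedLevels.sum _ fun c => hw _ _
  have hC : ∀ N i, IsClosed {x | ∃ k ≤ N, ∃ m : ℕ, m + N = i + k ∧ h x k (N + 1) = m} := by
    intro N i
    have : {x | ∃ k ≤ N, ∃ m : ℕ, m + N = i + k ∧ h x k (N + 1) = m} =
        ⋃ k ∈ Finset.range (N + 1), ⋃ m ∈ (Finset.range (i + k + 1)).filter (· + N = i + k),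
          {x | h x k (N + 1) = (m : ℕ)} := by
      ext x
      simp only [mem_ofPred_eq, mem_iUnion, Finset.mem_range, Finset.mem_filter, exists_prop]
      constructor
      · rintro ⟨k, hk, m, hm, hx⟩
        exact ⟨k, by omega, m, ⟨by omega, hm⟩, hx⟩
      · rintro ⟨k, hk, m, hm, hx⟩
        exact ⟨k, by omega, m, hm.2, hx⟩
    rw [this]
    exact isClosed_biUnion_finset fun k _ => isClosed_biUnion_finset fun m _ => hlev k (N + 1) m
  choose s hs hs' using fun N i =>
    perfectlyNormalSpace_iff_forall_isClosed_preimage_zero.1 inferInstance _ (hC N i)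
  refine ⟨fun x => (gateField fun N i => s N i x, (0, 0)), ?_, ?_⟩
  · exact (gateField.continuous.comp (continuous_pi fun N => continuous_pi fun i =>
      (s N i).continuous)).prodMk continuous_const
  · ext x
    have hmem : ∀ k, (∀ N, h x k N ≠ ⊤) ↔ x ∈ ⋂ i, E k i := by
      intro k
      rw [forall_laneHeight_ne_top]
      simp only [hwE]
      refine ⟨fun hx => mem_iInter.2 (hx k le_rfl), fun hx k' hk' => ?_⟩
      exact mem_iInter.1 (monotone_nat_of_le_succ (f := fun k => ⋂ i, E k i) hEk hk' hx)
    rw [mem_preimage, mem_globallySolvable_gateField, mem_iUnion,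
      gateField_mem_rightSolvable_iff (h := h x) (fun _ _ => laneHeight_le_succ)
        (fun _ _ => laneHeight_succ_le) (fun _ _ => laneHeight_succ_succ_le)
        (fun _ _ => laneHeight_eq_zero) (fun N i => (hs' N i x).1) fun N i => ?_]
    · exact exists_congr hmem
    · exact (Set.ext_iff.1 (hs N i) x).symm

theorem theorem5p21 : IsSigmaZeroComplete.{u, 0} 4 globallySolvable :=
  ⟨isSigmaFour_globallySolvable.isSigmaZero, isSigmaZeroHard_globallySolvable⟩
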